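/- For each sample size $n$ consider the linear model $y=X\beta^*+\sigma^*\varepsilon$ with $\varepsilon\sim N(0,I_n)$, where $X=X_n$ is a (non-random) $n\times p_n$ design matrix, $\beta^*=\beta^*_n\in\mathbb R^{p_n}$ has $s=s_n=\|\beta^*\|_0$ nonzero entries, and $\sigma^*>0$ is fixed. Let $P^*$ be the law of $y$. Asymptotics are as $n\to\infty$; for nonnegative sequences, $a\prec b$ means $a=o(b)$, and $a\asymp b$ means $a=O(b)$ and $b=O(a)$. Prior: $\sigma^2\sim \mathrm{IG}(a_0,b_0)$ with fixed $a_0,b_0>0$, and given $\sigma^2$, $\beta$ has density $\prod_{j=1}^{p_n} g_n(\beta_j/\sigma)/\sigma$, where each $g_n$ is a probability density on $\mathbb R$. Let $\pi(\cdot\mid D_n)$ be the posterior distribution of $(\beta,\sigma^2)$ given $D_n=(X,y)$, with density proportional to $\sigma^{-n}\exp(-\|y-X\beta\|^2/(2\sigma^2))$ times the prior density. Assume, with inequalities required only for all sufficiently large $n$: 1. Design: all entries of $X$ are bounded by $1$ in absolute value; $n=O(p_n)$; there are integers $\bar p=\bar p_n$ with $s\prec\bar p$ and a constant $\lambda_0>0$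 such that $\lambda_{\min}(X_\xi^TX_\xi)\ge n\lambda_0$ for every $\xi\subset\{1,\dots,p_n\}$ with $|\xi|\le\bar p$, where $X_\xi$ consists of the columns of $X$ in $\xi$. 2. Signal: $s\log p_n\prec n$; and $\max_j|\beta^*_j/\sigma^*|\le\gamma E_n$ for a constant $\gamma\in(0,1)$ and a nondecreasing sequence $E_n$. 3. Prior: there are a constant $u>0$ and a sequence $a_n\asymp\sqrt{s\log p_n/n}\,/p_n$ with $1-\int_{-a_n}^{a_n}g_n(x)\,dx\le p_n^{-(1+u)}$; moreover $\inf_{x\in[-E_n,E_n]}g_n(x)>0$ and $-\log\big(\inf_{x\in[-E_n,E_n]}g_n(x)\big)=O(\log p_n)$. Then there are positive constants $c_1,c_2,c_3$ and $M_0$ such that for every $M\ge M_0$, with $\epsilon_n=M\sqrt{s\log p_n/n}$, for all sufficiently large $n$, $$P^*\Big(\pi\big(\|X\beta-X\beta^*\|\ge c_1\sigma^*\sqrt n\,\epsilon_n\mid D_n\big)\ge e^{-c_2n\epsilon_n^2}\Big)\le e^{-c_3n\epsilon_n^2},$$ where $\|\cdot\|$ is the Euclidean norm. -/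

import Mathlib

open MeasureTheory ProbabilityTheory Filter Asymptotics

namespace Shrinkage

noncomputable section

/-- The Euclidean norm of a vector of reals (`Fin n → ℝ` itself carries the sup norm). -/
def l2norm {n : ℕ} (v : Fin n → ℝ) : ℝ := ‖WithLp.toLp 2 v‖

/-- The number of nonzero entries of a vector. -/
def sparsity {p : ℕ} (β : Fin p → ℝ) : ℕ := (Finset.univ.filter fun j => β j ≠ 0).card

/-- The sub-design matrix consisting of the columns in the subset model `ξ`. -/
def subDesign {n p : ℕ} (X : Matrix (Fin n) (Fin p) ℝ) (ξ : Finset (Fin p)) :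
    Matrix (Fin n) {j // j ∈ ξ} ℝ :=
  X.submatrix id Subtype.val

/-- The law of the response `y = X β + σ ε` with `ε ∼ N(0, I_n)`. -/
def dataLaw {n p : ℕ} (X : Matrix (Fin n) (Fin p) ℝ) (β : Fin p → ℝ) (σ : ℝ) :
    Measure (Fin n → ℝ) :=
  (Measure.pi fun _ : Fin n => gaussianReal 0 1).map fun ε => X.mulVec β + σ • ε

/-- The density of the inverse-gamma distribution with shape `a` and scale `b`. -/
def invGammaPDF (a b t : ℝ) : ℝ :=
  if 0 < t then b ^ a / Real.Gamma a * t ^ (-a - 1) * Real.exp (-b / t) else 0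

/-- The joint prior density of `(β, σ²)`, evaluated at `θ = (β, σ²)`: `σ²` is inverse-gamma and,
given `σ²`, the entries of `β` are independent with density `g (· / σ) / σ`. -/
def priorDensity (a₀ b₀ : ℝ) (g : ℝ → ℝ) {p : ℕ} (θ : (Fin p → ℝ) × ℝ) : ℝ :=
  invGammaPDF a₀ b₀ θ.2 * ∏ j, g (θ.1 j / √θ.2) / √θ.2

/-- The likelihood of `θ = (β, σ²)` given the response `y`: the density of `N(X β, σ² I_n)` at
`y`. -/
def likelihood {n p : ℕ} (X : Matrix (Fin n) (Fin p) ℝ) (y : Fin n → ℝ)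
    (θ : (Fin p → ℝ) × ℝ) : ℝ :=
  (√(2 * Real.pi * θ.2))⁻¹ ^ n * Real.exp (-(l2norm (y - X.mulVec θ.1)) ^ 2 / (2 * θ.2))

/-- Likelihood times prior, as a measure on the parameters `(β, σ²)`. -/
def unnormalizedPosterior (a₀ b₀ : ℝ) (g : ℝ → ℝ) {n p : ℕ} (X : Matrix (Fin n) (Fin p) ℝ)
    (y : Fin n → ℝ) : Measure ((Fin p → ℝ) × ℝ) :=
  volume.withDensity fun θ => ENNReal.ofReal (likelihood X y θ * priorDensity a₀ b₀ g θ)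

/-- The posterior distribution of `(β, σ²)` given the data `(X, y)`. -/
def posterior (a₀ b₀ : ℝ) (g : ℝ → ℝ) {n p : ℕ} (X : Matrix (Fin n) (Fin p) ℝ)
    (y : Fin n → ℝ) : Measure ((Fin p → ℝ) × ℝ) :=
  (unnormalizedPosterior a₀ b₀ g X y Set.univ)⁻¹ • unnormalizedPosterior a₀ b₀ g X y

/-- `√(s log p / n)`. -/
def baseRate (s p n : ℕ) : ℝ := √(s * Real.log p / n)

/-- The conditions on the design matrices: bounded covariates, high dimension, and a lower
eigenvalue bound for all submodels of size at most some `pbar ≻ s`. -/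
structure DesignCondition (p : ℕ → ℕ) (X : ∀ n, Matrix (Fin n) (Fin (p n)) ℝ)
    (βs : ∀ n, Fin (p n) → ℝ) : Prop where
  bounded : ∀ᶠ n in atTop, ∀ i j, |X n i j| ≤ 1
  high_dim : (fun n : ℕ => (n : ℝ)) =O[atTop] fun n => (p n : ℝ)
  small_eig : ∃ (pbar : ℕ → ℕ) (lam₀ : ℝ), 0 < lam₀ ∧
    (fun n => (sparsity (βs n) : ℝ)) =o[atTop] (fun n => (pbar n : ℝ)) ∧
    ∀ᶠ n in atTop, ∀ ξ : Finset (Fin (p n)), ξ.card ≤ pbar n →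
      ∀ μ ∈ spectrum ℝ ((subDesign (X n) ξ).transpose * subDesign (X n) ξ), n * lam₀ ≤ μ

/-- The conditions on the true coefficients: sparsity and bounded magnitude. -/
structure SignalCondition (p : ℕ → ℕ) (βs : ∀ n, Fin (p n) → ℝ) (σs : ℝ) (E : ℕ → ℝ) :
    Prop where
  sparse : (fun n => (sparsity (βs n) : ℝ) * Real.log (p n)) =o[atTop] fun n : ℕ => (n : ℝ)
  magnitude : ∃ γ : ℝ, 0 < γ ∧ γ < 1 ∧ ∀ᶠ n in atTop, ∀ j, |βs n j / σs| ≤ γ * E n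
  monotone_E : Monotone E

/-- The conditions on the prior densities `g n`: concentration on `[-a n, a n]` with
`a n ≍ √(s log p / n) / p`, and `-log (inf_{[-E n, E n]} g n) = O(log p)`, the infimum being
positive for all large `n`, so that its logarithm is meaningful. -/
structure PriorCondition (p : ℕ → ℕ) (βs : ∀ n, Fin (p n) → ℝ) (E : ℕ → ℝ)
    (g : ℕ → ℝ → ℝ) : Prop where
  concentration : ∃ (u : ℝ) (a : ℕ → ℝ), 0 < u ∧
    (a =Θ[atTop] fun n => baseRate (sparsity (βs n)) (p n) n / p n) ∧
    ∀ᶠ n in atTop, 1 - ∫ x in Set.Icc (-a n) (a n), g n x ≤ (p n : ℝ) ^ (-(1 + u))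
  thick_pos : ∀ᶠ n in atTop, 0 < sInf (g n '' Set.Icc (-E n) (E n))
  thick : (fun n => -Real.log (sInf (g n '' Set.Icc (-E n) (E n)))) =O[atTop]
    fun n => Real.log (p n)

end

end Shrinkage

namespace Shrinkage

/-! ### Product densities and scaling on `Fin n → ℝ`. -/

open scoped ENNReal NNReal RealInnerProductSpace

/-! The posterior mass of the bad set is a ratio of two integrals of the likelihood. Both are
compared with `exp (maxLogLik n v)`, the largest likelihood at the true coefficients over all
variances, attained at v = σ*²‖ε‖²/n. Write L = s log p and Λ = M²L = nε_n².

Denominator: take the parameters whose coefficients are all within ρσ of the truth, ρ ≍ √(L/n)/p,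
and whose variance lies in [v, v(1 + L/n)]. There the likelihood is within a factor e^{-O(ML)} of
the reference (`le_likelihood_of_mem_nearBox`). The prior mass is e^{-O(L)}
(`exp_le_priorMeasure_nearBox`): concentration makes the zero coordinates together cost only a
constant, and each of the s others costs a power of p. For M large the total loss is at most e^Λ.

Numerator: three pieces. Variances above e⁵σ*² lose a factor e^{-n}. Parameters with k of order
Λ/log p coefficients above ρσ have prior mass O(e^{-5Λ}), and the expected integrated likelihood
ratio over a set is at most its prior mass, so Markov's inequality applies
(`dataLaw_unnormalizedPosterior_gt_le`). For the remaining parameters, β - β* is a sparse vector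
plus a vector of tiny ℓ¹ norm; its image under X then has small correlation with the noise, the
residual sum of squares grows by at least ‖X(β - β*)‖²/2 (`residual_sq_ge`), and the likelihood
maximized over the variance drops by e^{-3Λ}.

The noise is good if ‖ε‖² lies between κn and 2n and its projections on all spans of few columns are
small; chi-square tails and a union bound over column choices give this
(`dataLaw_le_of_good_noise`). -/

theorem lintegral_fin_prod {n : ℕ} (μ : Fin n → Measure ℝ) [∀ i, SigmaFinite (μ i)]
    (f : Fin n → ℝ → ℝ≥0∞) (hf : ∀ i, Measurable (f i)) :
    ∫⁻ x, ∏ i, f i (x i) ∂(Measure.pi μ) = ∏ i, ∫⁻ x, f i x ∂(μ i) := by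
  induction n with
  | zero => simp
  | succ n ih =>
    rw [← ((measurePreserving_piFinSuccAbove μ 0).symm).lintegral_comp (by fun_prop)]
    simp_rw [MeasurableEquiv.piFinSuccAbove_symm_apply, Fin.insertNthEquiv,
      Fin.prod_univ_succ, Fin.insertNth_zero]
    simp only [Fin.zero_succAbove, Equiv.coe_fn_mk, Fin.cons_succ, cast_eq]
    rw [← ih _ (fun i => f i.succ) (fun i => hf _)]
    exact lintegral_prod_mul (μ := μ 0) (ν := Measure.pi fun j : Fin n => μ j.succ)
      (f := f 0) (g := fun a : Fin n → ℝ => ∏ x, f x.succ (a x))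
      (hf 0).aemeasurable
      (Finset.measurable_prod _ fun i _ => (hf _).comp (measurable_pi_apply i)).aemeasurable

theorem pi_withDensity {n : ℕ} (f : Fin n → ℝ → ℝ≥0∞) (hf : ∀ i, Measurable (f i))
    [∀ i, SigmaFinite ((volume : Measure ℝ).withDensity (f i))] :
    Measure.pi (fun i => (volume : Measure ℝ).withDensity (f i)) =
      (volume : Measure (Fin n → ℝ)).withDensity fun x => ∏ i, f i (x i) := by
  refine (Measure.pi_eq fun s hs => ?_)
  rw [withDensity_apply _ (MeasurableSet.univ_pi hs), volume_pi, Measure.restrict_pi_pi,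
    lintegral_fin_prod _ _ hf]
  simp [withDensity_apply _ (hs _)]

theorem lintegral_comp_smul_fin {p : ℕ} {c : ℝ} (hc : 0 < c) (f : (Fin p → ℝ) → ℝ≥0∞)
    (hf : Measurable f) :
    ∫⁻ x, f (c • x) * ENNReal.ofReal (c ^ p) = ∫⁻ x, f x := by
  have h := Measure.map_addHaar_smul (volume : Measure (Fin p → ℝ)) hc.ne'
  have h2 : ∫⁻ x, f (c • x) = ∫⁻ x, f x ∂(Measure.map (fun x => c • x) volume) := by
    rw [lintegral_map hf (by fun_prop)]
  rw [lintegral_mul_const _ (by fun_prop), h2, h, lintegral_smul_measure]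
  have hcp : 0 < c ^ p := by positivity
  simp only [Module.finrank_fin_fun, smul_eq_mul, abs_inv, abs_of_pos hcp]
  rw [mul_comm, ← mul_assoc, ← ENNReal.ofReal_mul hcp.le, mul_inv_cancel₀ hcp.ne']
  simp

/-! ### Prior and likelihood as measures; Markov's inequality under the truth. -/

/-- The prior law of a standardized coefficient `β_j / σ`. -/
noncomputable def coordLaw (g : ℝ → ℝ) : Measure ℝ :=
  volume.withDensity fun x => ENNReal.ofReal (g x)

/-- The joint prior law of `(β, σ²)`. -/
noncomputable def priorMeasure (a₀ b₀ : ℝ) (g : ℝ → ℝ) (p : ℕ) : Measure ((Fin p → ℝ) × ℝ) :=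
  volume.withDensity fun θ => ENNReal.ofReal (priorDensity a₀ b₀ g θ)

theorem measurable_invGammaPDF (a b : ℝ) : Measurable (invGammaPDF a b) := by
  unfold invGammaPDF
  refine Measurable.ite measurableSet_Ioi ?_ measurable_const
  fun_prop

theorem invGammaPDF_nonneg {a b : ℝ} (ha : 0 < a) (hb : 0 < b) (t : ℝ) :
    0 ≤ invGammaPDF a b t := by
  unfold invGammaPDF
  split_ifs with h
  · have := Real.Gamma_pos_of_pos ha
    positivity
  · rfl

theorem measurable_priorDensity (a₀ b₀ : ℝ) {g : ℝ → ℝ} (hg : Measurable g) (p : ℕ) :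
    Measurable fun θ : (Fin p → ℝ) × ℝ => priorDensity a₀ b₀ g θ := by
  unfold priorDensity
  refine Measurable.mul ((measurable_invGammaPDF _ _).comp measurable_snd) ?_
  refine Finset.measurable_prod _ fun j _ => ?_
  exact (hg.comp (by fun_prop)).div (by fun_prop)

theorem measurable_likelihood_uncurry {n p : ℕ} (X : Matrix (Fin n) (Fin p) ℝ) :
    Measurable fun z : (Fin n → ℝ) × ((Fin p → ℝ) × ℝ) => likelihood X z.1 z.2 := by
  unfold likelihood l2norm
  have h : Measurable fun z : (Fin n → ℝ) × ((Fin p → ℝ) × ℝ) =>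
      ‖WithLp.toLp 2 (z.1 - X.mulVec z.2.1)‖ := by
    apply Continuous.measurable
    fun_prop
  fun_prop

theorem integrable_of_integral_eq_one {g : ℝ → ℝ} (hg1 : ∫ x, g x = 1) : Integrable g := by
  by_contra h
  rw [integral_undef h] at hg1
  exact zero_ne_one hg1

theorem isProbabilityMeasure_coordLaw {g : ℝ → ℝ} (hg0 : ∀ x, 0 ≤ g x)
    (hg1 : ∫ x, g x = 1) : IsProbabilityMeasure (coordLaw g) := by
  refine ⟨?_⟩
  rw [coordLaw, withDensity_apply _ MeasurableSet.univ, Measure.restrict_univ,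
    ← ofReal_integral_eq_lintegral_ofReal (integrable_of_integral_eq_one hg1)
      (ae_of_all _ hg0), hg1, ENNReal.ofReal_one]

/-- Substituting β = √t x absorbs the factors 1/√t, so given σ² = t the standardized coefficients
are i.i.d. with law `coordLaw g`. All prior estimates reduce to product measures through this
formula. -/
theorem priorMeasure_apply {a₀ b₀ : ℝ} (ha : 0 < a₀) (hb : 0 < b₀) {g : ℝ → ℝ}
    (hgm : Measurable g) (hg0 : ∀ x, 0 ≤ g x) (hg1 : ∫ x, g x = 1) (p : ℕ)
    {A : Set ((Fin p → ℝ) × ℝ)} (hA : MeasurableSet A) :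
    priorMeasure a₀ b₀ g p A = ∫⁻ t, ENNReal.ofReal (invGammaPDF a₀ b₀ t) *
      (Measure.pi fun _ : Fin p => coordLaw g) {x | (√t • x, t) ∈ A} := by
  have := isProbabilityMeasure_coordLaw hg0 hg1
  have hD := measurable_priorDensity a₀ b₀ hgm p
  have hF : Measurable (A.indicator fun θ => ENNReal.ofReal (priorDensity a₀ b₀ g θ)) :=
    hD.ennreal_ofReal.indicator hA
  rw [priorMeasure, withDensity_apply _ hA, ← lintegral_indicator hA, Measure.volume_eq_prod,
    lintegral_prod_symm' _ hF]
  refine lintegral_congr fun t => ?_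
  rcases le_or_gt t 0 with ht | ht
  · have h0 : invGammaPDF a₀ b₀ t = 0 := by simp [invGammaPDF, not_lt.2 ht]
    simp [Set.indicator, priorDensity, h0]
  have hc : 0 < √t := Real.sqrt_pos.2 ht
  rw [← lintegral_comp_smul_fin hc (fun x => A.indicator _ (x, t)) (hF.comp (measurable_id.prodMk measurable_const))]
  have hsl : MeasurableSet {x : Fin p → ℝ | (√t • x, t) ∈ A} :=
    hA.preimage (f := fun x : Fin p → ℝ => (√t • x, t)) (by fun_prop)
  have : (Measure.pi fun _ : Fin p => coordLaw g) =
      (volume : Measure (Fin p → ℝ)).withDensity fun x => ∏ i, ENNReal.ofReal (g (x i)) := by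
    have : SigmaFinite ((volume : Measure ℝ).withDensity fun x => ENNReal.ofReal (g x)) := by
      change SigmaFinite (coordLaw g); infer_instance
    exact pi_withDensity (fun _ x => ENNReal.ofReal (g x)) fun _ => hgm.ennreal_ofReal
  rw [this, withDensity_apply _ hsl, ← lintegral_indicator hsl, ← lintegral_const_mul]
  · refine lintegral_congr fun x => ?_
    by_cases hx : (√t • x, t) ∈ A
    · have hx' : x ∈ {x : Fin p → ℝ | (√t • x, t) ∈ A} := hx
      rw [Set.indicator_of_mem hx, Set.indicator_of_mem hx', ← ENNReal.ofReal_prod_of_nonneg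
        (fun i _ => hg0 _), ← ENNReal.ofReal_mul (invGammaPDF_nonneg ha hb t),
        ← ENNReal.ofReal_mul' (by positivity)]
      congr 1
      simp only [priorDensity, Pi.smul_apply, smul_eq_mul, Finset.prod_div_distrib,
        Finset.prod_const, Finset.card_univ, Fintype.card_fin, mul_div_cancel_left₀ _ hc.ne']
      field_simp
    · have hx' : x ∉ {x : Fin p → ℝ | (√t • x, t) ∈ A} := hx
      rw [Set.indicator_of_notMem hx, Set.indicator_of_notMem hx']
      simp
  · refine Measurable.indicator ?_ hsl
    exact Finset.measurable_prod _ fun i _ => (hgm.comp (measurable_pi_apply i)).ennreal_ofReal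

/-- The substitution t ↦ t⁻¹ gives a gamma integral. Finiteness suffices below; the total mass only
enters as the constant `Cπ`. -/
theorem lintegral_invGammaPDF_lt_top {a b : ℝ} (ha : 0 < a) (hb : 0 < b) :
    ∫⁻ t, ENNReal.ofReal (invGammaPDF a b t) < ∞ := by
  have h1 : IntegrableOn (fun x : ℝ => x ^ (a - 1) * Real.exp (-b * x)) (Set.Ioi 0) := by
    have := integrableOn_rpow_mul_exp_neg_mul_rpow (s := a - 1) (p := 1) (b := b)
      (by linarith) one_pos hb
    simpa using this
  have h2 := (integrableOn_Ioi_comp_rpow_iff (fun x : ℝ => x ^ (a - 1) * Real.exp (-b * x))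
    (p := -1) (by norm_num)).2 h1
  have h3 : IntegrableOn (invGammaPDF a b) (Set.Ioi 0) := by
    refine IntegrableOn.congr_fun (h2.const_mul (b ^ a / Real.Gamma a)) (fun t (ht : 0 < t) => ?_)
      measurableSet_Ioi
    simp only [invGammaPDF, if_pos ht, smul_eq_mul, abs_neg, abs_one, one_mul]
    rw [Real.rpow_neg_one, ← div_eq_mul_inv, ← mul_assoc, ← mul_assoc, mul_assoc (b ^ a / _)]
    congr 2
    rw [Real.inv_rpow ht.le, ← Real.rpow_neg ht.le, ← Real.rpow_add ht]
    congr 1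
    ring
  have h4 : Integrable (invGammaPDF a b) := by
    rw [← integrableOn_univ, ← Set.Iic_union_Ioi (a := (0:ℝ))]
    refine IntegrableOn.union ?_ h3
    refine integrableOn_zero.congr_fun (fun t (ht : t ≤ 0) => ?_) measurableSet_Iic
    simp [invGammaPDF, not_lt.2 ht]
  exact h4.lintegral_lt_top

theorem l2norm_sq {n : ℕ} (v : Fin n → ℝ) : l2norm v ^ 2 = ∑ i, v i ^ 2 := by
  simp [l2norm, EuclideanSpace.real_norm_sq_eq]

theorem l2norm_nonneg {n : ℕ} (v : Fin n → ℝ) : 0 ≤ l2norm v := norm_nonneg _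

theorem likelihood_nonneg {n p : ℕ} (X : Matrix (Fin n) (Fin p) ℝ) (y : Fin n → ℝ)
    (θ : (Fin p → ℝ) × ℝ) : 0 ≤ likelihood X y θ := by
  unfold likelihood; positivity

theorem likelihood_eq_prod_gaussianPDFReal {n p : ℕ} (X : Matrix (Fin n) (Fin p) ℝ)
    (y : Fin n → ℝ) (β : Fin p → ℝ) {t : ℝ} (ht : 0 < t) :
    likelihood X y (β, t) = ∏ i, gaussianPDFReal (X.mulVec β i) t.toNNReal (y i) := by
  simp only [likelihood, gaussianPDFReal, Finset.prod_mul_distrib, Finset.prod_const,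
    Finset.card_univ, Fintype.card_fin, ← Real.exp_sum, Real.coe_toNNReal t ht.le]
  congr 2
  rw [l2norm_sq, ← Finset.sum_div, ← Finset.sum_neg_distrib]
  simp

theorem pi_gaussianReal_eq_withDensity {n p : ℕ} (X : Matrix (Fin n) (Fin p) ℝ)
    (β : Fin p → ℝ) {t : ℝ} (ht : 0 < t) :
    Measure.pi (fun i => gaussianReal (X.mulVec β i) t.toNNReal) =
      volume.withDensity fun y => ENNReal.ofReal (likelihood X y (β, t)) := by
  have hv : t.toNNReal ≠ 0 := by simpa using ht
  have h : ∀ i, SigmaFinite ((volume : Measure ℝ).withDensity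
      (gaussianPDF (X.mulVec β i) t.toNNReal)) := fun i => by
    rw [← gaussianReal_of_var_ne_zero _ hv]; infer_instance
  simp_rw [gaussianReal_of_var_ne_zero _ hv]
  rw [pi_withDensity _ fun i => measurable_gaussianPDF _ _]
  congr 1
  ext y
  rw [likelihood_eq_prod_gaussianPDFReal X y β ht,
    ENNReal.ofReal_prod_of_nonneg fun i _ => gaussianPDFReal_nonneg _ _ _]
  rfl

theorem dataLaw_eq_withDensity {n p : ℕ} (X : Matrix (Fin n) (Fin p) ℝ) (β : Fin p → ℝ)
    {σ : ℝ} (hσ : 0 < σ) :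
    dataLaw X β σ = volume.withDensity fun y => ENNReal.ofReal (likelihood X y (β, σ ^ 2)) := by
  rw [← pi_gaussianReal_eq_withDensity X β (by positivity : 0 < σ ^ 2), dataLaw]
  have h : ∀ i, gaussianReal (X.mulVec β i) (σ ^ 2).toNNReal =
      (gaussianReal 0 1).map fun x => X.mulVec β i + σ * x := fun i => by
    rw [show (fun x => X.mulVec β i + σ * x) = (fun x => X.mulVec β i + x) ∘ (fun x => σ * x)
      from rfl, ← Measure.map_map (by fun_prop) (by fun_prop), gaussianReal_map_const_mul,
      gaussianReal_map_const_add]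
    congr 1
    · simp
    · ext; simp [Real.coe_toNNReal _ (sq_nonneg σ)]
  have h' : ∀ i : Fin n, SigmaFinite ((gaussianReal 0 1).map fun x => X.mulVec β i + σ * x) :=
    fun i => by rw [← h]; infer_instance
  simp_rw [h]
  rw [← Measure.pi_map_pi (fun i => by fun_prop)]
  rfl

theorem lintegral_likelihood_le_one {n p : ℕ} (hn : n ≠ 0) (X : Matrix (Fin n) (Fin p) ℝ)
    (θ : (Fin p → ℝ) × ℝ) : ∫⁻ y, ENNReal.ofReal (likelihood X y θ) ≤ 1 := by
  obtain ⟨β, t⟩ := θ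
  rcases le_or_gt t 0 with ht | ht
  · have : √(2 * Real.pi * t) = 0 := Real.sqrt_eq_zero_of_nonpos
      (mul_nonpos_of_nonneg_of_nonpos (by positivity) ht)
    simp [likelihood, this, hn]
  · rw [← setLIntegral_univ, ← withDensity_apply _ MeasurableSet.univ,
      ← pi_gaussianReal_eq_withDensity X β ht]
    exact prob_le_one

theorem measurable_likelihood {n p : ℕ} (X : Matrix (Fin n) (Fin p) ℝ) (y : Fin n → ℝ) :
    Measurable (likelihood X y) :=
  (measurable_likelihood_uncurry X).comp (measurable_const.prodMk measurable_id)

theorem measurable_likelihood_left {n p : ℕ} (X : Matrix (Fin n) (Fin p) ℝ)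
    (θ : (Fin p → ℝ) × ℝ) : Measurable fun y => likelihood X y θ :=
  (measurable_likelihood_uncurry X).comp (measurable_id.prodMk measurable_const)

instance (a₀ b₀ : ℝ) (g : ℝ → ℝ) (p : ℕ) : SFinite (priorMeasure a₀ b₀ g p) := by
  unfold priorMeasure; infer_instance

theorem unnormalizedPosterior_apply {a₀ b₀ : ℝ} {g : ℝ → ℝ} (hg : Measurable g) {n p : ℕ}
    (X : Matrix (Fin n) (Fin p) ℝ) (y : Fin n → ℝ) (A : Set ((Fin p → ℝ) × ℝ)) :
    unnormalizedPosterior a₀ b₀ g X y A =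
      ∫⁻ θ in A, ENNReal.ofReal (likelihood X y θ) ∂(priorMeasure a₀ b₀ g p) := by
  rw [← withDensity_apply', priorMeasure, ← withDensity_mul _
    (measurable_priorDensity a₀ b₀ hg p).ennreal_ofReal
    (measurable_likelihood X y).ennreal_ofReal, unnormalizedPosterior]
  congr 2
  ext θ
  rw [Pi.mul_apply, ENNReal.ofReal_mul (likelihood_nonneg X y θ), mul_comm]

/-- Under the true law the likelihood at the truth is the density of y, so it cancels in the
likelihood ratio; by Tonelli the ratio integrated over B has expectation at most the prior mass of
B. Markov's inequality finishes. -/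
theorem dataLaw_unnormalizedPosterior_gt_le {a₀ b₀ : ℝ} {g : ℝ → ℝ} (hg : Measurable g)
    {n p : ℕ} (hn : n ≠ 0) (X : Matrix (Fin n) (Fin p) ℝ) (β : Fin p → ℝ) {σ : ℝ} (hσ : 0 < σ)
    {c : ℝ} (hc : 0 < c) (B : Set ((Fin p → ℝ) × ℝ)) :
    dataLaw X β σ {y | ENNReal.ofReal (c * likelihood X y (β, σ ^ 2)) <
      unnormalizedPosterior a₀ b₀ g X y B} ≤
      ENNReal.ofReal c⁻¹ * priorMeasure a₀ b₀ g p B := by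
  set Pm := priorMeasure a₀ b₀ g p
  simp_rw [unnormalizedPosterior_apply hg]
  have hm : Measurable fun y => ∫⁻ θ in B, ENNReal.ofReal (likelihood X y θ) ∂Pm :=
    (measurable_likelihood_uncurry X).ennreal_ofReal.lintegral_prod_right'
  have hl := (measurable_likelihood_left X (β, σ ^ 2))
  set S := {y | ENNReal.ofReal (c * likelihood X y (β, σ ^ 2)) <
    ∫⁻ θ in B, ENNReal.ofReal (likelihood X y θ) ∂Pm}
  have hS : MeasurableSet S := measurableSet_lt (hl.const_mul c).ennreal_ofReal hm
  have key : ENNReal.ofReal c * dataLaw X β σ S ≤ Pm B := by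
    rw [dataLaw_eq_withDensity X β hσ, withDensity_apply _ hS,
      ← lintegral_const_mul _ hl.ennreal_ofReal]
    calc ∫⁻ y in S, ENNReal.ofReal c * ENNReal.ofReal (likelihood X y (β, σ ^ 2))
        ≤ ∫⁻ y in S, ∫⁻ θ in B, ENNReal.ofReal (likelihood X y θ) ∂Pm := by
          refine setLIntegral_mono hm fun y hy => ?_
          rw [← ENNReal.ofReal_mul hc.le]
          exact le_of_lt hy
      _ ≤ ∫⁻ y, ∫⁻ θ in B, ENNReal.ofReal (likelihood X y θ) ∂Pm := setLIntegral_le_lintegral _ _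
      _ = ∫⁻ θ in B, (∫⁻ y, ENNReal.ofReal (likelihood X y θ)) ∂Pm :=
          lintegral_lintegral_swap (f := fun y θ => ENNReal.ofReal (likelihood X y θ))
            (measurable_likelihood_uncurry X).ennreal_ofReal.aemeasurable
      _ ≤ ∫⁻ θ in B, 1 ∂Pm := lintegral_mono fun θ => lintegral_likelihood_le_one hn X θ
      _ = Pm B := by simp
  rw [ENNReal.ofReal_inv_of_pos hc, mul_comm, ← div_eq_mul_inv]
  rw [ENNReal.le_div_iff_mul_le (Or.inl (by simpa using hc)) (Or.inl ENNReal.ofReal_ne_top),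
    mul_comm]
  exact key

/-! ### Prior mass of sets with many large coefficients and of boxes around the truth. -/

theorem coordLaw_Icc {g : ℝ → ℝ} (hg0 : ∀ x, 0 ≤ g x) (hg1 : ∫ x, g x = 1) (a b : ℝ) :
    coordLaw g (Set.Icc a b) = ENNReal.ofReal (∫ x in Set.Icc a b, g x) := by
  rw [coordLaw, withDensity_apply _ measurableSet_Icc, ← ofReal_integral_eq_lintegral_ofReal
    (integrable_of_integral_eq_one hg1).integrableOn (ae_of_all _ hg0)]

theorem coordLaw_abs_gt_le {g : ℝ → ℝ} (hg0 : ∀ x, 0 ≤ g x) (hg1 : ∫ x, g x = 1) {ρ q : ℝ}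
    (hq : 1 - ∫ x in Set.Icc (-ρ) ρ, g x ≤ q) :
    coordLaw g {x | ρ < |x|} ≤ ENNReal.ofReal q := by
  have := isProbabilityMeasure_coordLaw hg0 hg1
  have h : {x : ℝ | ρ < |x|} = (Set.Icc (-ρ) ρ)ᶜ := by
    ext x; simp [← abs_le]
  rw [h, prob_compl_eq_one_sub measurableSet_Icc, coordLaw_Icc hg0 hg1, ← ENNReal.ofReal_one,
    ← ENNReal.ofReal_sub _ (setIntegral_nonneg measurableSet_Icc fun x _ => hg0 x)]
  exact ENNReal.ofReal_le_ofReal hq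

theorem le_coordLaw_Icc {g : ℝ → ℝ} {δ a b : ℝ} (h0 : 0 ≤ δ) (hδ : ∀ x ∈ Set.Icc a b, δ ≤ g x) :
    ENNReal.ofReal (δ * (b - a)) ≤ coordLaw g (Set.Icc a b) := by
  rw [coordLaw, withDensity_apply _ measurableSet_Icc]
  calc ENNReal.ofReal (δ * (b - a)) = ∫⁻ x in Set.Icc a b, ENNReal.ofReal δ := by
        rw [setLIntegral_const, Real.volume_Icc, ENNReal.ofReal_mul h0]
    _ ≤ _ := setLIntegral_mono' measurableSet_Icc fun x hx => ENNReal.ofReal_le_ofReal (hδ x hx)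

/-- The parameters with `k` coefficients exceeding `ρ σ`. -/
def manyLarge (p k : ℕ) (ρ : ℝ) : Set ((Fin p → ℝ) × ℝ) :=
  {θ | ∃ ξ : Finset (Fin p), ξ.card = k ∧ ∀ j ∈ ξ, ρ * √θ.2 < |θ.1 j|}

theorem measurableSet_manyLarge (p k : ℕ) (ρ : ℝ) : MeasurableSet (manyLarge p k ρ) := by
  have : manyLarge p k ρ = ⋃ ξ : Finset (Fin p), ⋃ _ : ξ.card = k, ⋂ j ∈ ξ,
      {θ : (Fin p → ℝ) × ℝ | ρ * √θ.2 < |θ.1 j|} := by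
    ext θ; simp [manyLarge]
  rw [this]
  refine MeasurableSet.iUnion fun ξ => MeasurableSet.iUnion fun _ =>
    Finset.measurableSet_biInter _ fun j _ => measurableSet_lt (by fun_prop) (by fun_prop)

/-- Union bound over the k-subsets, of which there are at most p ^ k. -/
theorem pi_exists_finset_abs_gt_le {ν : Measure ℝ} [IsProbabilityMeasure ν] {p k : ℕ} {ρ q : ℝ}
    (hq0 : 0 ≤ q) (hq : ν {x | ρ < |x|} ≤ ENNReal.ofReal q) :
    Measure.pi (fun _ : Fin p => ν) {x | ∃ ξ : Finset (Fin p), ξ.card = k ∧ ∀ j ∈ ξ, ρ < |x j|} ≤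
      ENNReal.ofReal ((p * q) ^ k) := by
  have hsub : {x : Fin p → ℝ | ∃ ξ : Finset (Fin p), ξ.card = k ∧ ∀ j ∈ ξ, ρ < |x j|} ⊆
      ⋃ ξ ∈ Finset.powersetCard k (Finset.univ : Finset (Fin p)),
        (ξ : Set (Fin p)).pi fun _ => {x : ℝ | ρ < |x|} := by
    rintro x ⟨ξ, h1, h2⟩
    simp only [Set.mem_iUnion]
    exact ⟨ξ, by simp [h1], fun j hj => h2 j hj⟩
  refine (measure_mono hsub).trans ((measure_biUnion_finset_le _ _).trans ?_)
  calc ∑ ξ ∈ Finset.powersetCard k (Finset.univ : Finset (Fin p)),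
        Measure.pi (fun _ : Fin p => ν) ((ξ : Set (Fin p)).pi fun _ => {x : ℝ | ρ < |x|})
      ≤ ∑ ξ ∈ Finset.powersetCard k (Finset.univ : Finset (Fin p)), ENNReal.ofReal (q ^ k) := by
        refine Finset.sum_le_sum fun ξ hξ => ?_
        rw [Measure.pi_pi_finset, Finset.prod_const, (Finset.mem_powersetCard.1 hξ).2,
          ENNReal.ofReal_pow hq0]
        gcongr
    _ = ENNReal.ofReal (p.choose k * q ^ k) := by
        rw [Finset.sum_const, Finset.card_powersetCard, Finset.card_univ, Fintype.card_fin,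
          nsmul_eq_mul, ENNReal.ofReal_mul (by positivity), ENNReal.ofReal_natCast]
    _ ≤ ENNReal.ofReal ((p * q) ^ k) := by
        rw [mul_pow]
        gcongr
        exact_mod_cast Nat.choose_le_pow p k

section Prior

variable {a₀ b₀ : ℝ} {g : ℝ → ℝ}

theorem priorMeasure_univ_le (ha : 0 < a₀) (hb : 0 < b₀) (hgm : Measurable g)
    (hg0 : ∀ x, 0 ≤ g x) (hg1 : ∫ x, g x = 1) (p : ℕ) :
    priorMeasure a₀ b₀ g p Set.univ ≤ ∫⁻ t, ENNReal.ofReal (invGammaPDF a₀ b₀ t) := by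
  have := isProbabilityMeasure_coordLaw hg0 hg1
  rw [priorMeasure_apply ha hb hgm hg0 hg1 p MeasurableSet.univ]
  exact lintegral_mono fun t => by simp

theorem priorMeasure_manyLarge_le (ha : 0 < a₀) (hb : 0 < b₀) (hgm : Measurable g)
    (hg0 : ∀ x, 0 ≤ g x) (hg1 : ∫ x, g x = 1) (p k : ℕ) {ρ q : ℝ} (hq0 : 0 ≤ q)
    (hq : 1 - ∫ x in Set.Icc (-ρ) ρ, g x ≤ q) :
    priorMeasure a₀ b₀ g p (manyLarge p k ρ) ≤
      (∫⁻ t, ENNReal.ofReal (invGammaPDF a₀ b₀ t)) * ENNReal.ofReal ((p * q) ^ k) := by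
  have := isProbabilityMeasure_coordLaw hg0 hg1
  rw [priorMeasure_apply ha hb hgm hg0 hg1 p (measurableSet_manyLarge p k ρ),
    ← lintegral_mul_const _ (measurable_invGammaPDF _ _).ennreal_ofReal]
  refine lintegral_mono fun t => ?_
  rcases le_or_gt t 0 with ht | ht
  · simp [invGammaPDF, not_lt.2 ht]
  have hc : 0 < √t := Real.sqrt_pos.2 ht
  have h : {x : Fin p → ℝ | (√t • x, t) ∈ manyLarge p k ρ} =
      {x | ∃ ξ : Finset (Fin p), ξ.card = k ∧ ∀ j ∈ ξ, ρ < |x j|} := by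
    ext x
    simp only [manyLarge, Set.mem_ofPred_eq, Pi.smul_apply, smul_eq_mul, abs_mul, abs_of_pos hc,
      mul_comm ρ, mul_lt_mul_iff_right₀ hc]
  rw [h]
  gcongr
  exact pi_exists_finset_abs_gt_le hq0 (coordLaw_abs_gt_le hg0 hg1 hq)

/-- The parameters close to `β` in every coordinate, with `σ²` in a given interval. -/
def nearBox {p : ℕ} (β : Fin p → ℝ) (t₁ t₂ ρ : ℝ) : Set ((Fin p → ℝ) × ℝ) :=
  {θ | θ.2 ∈ Set.Icc t₁ t₂ ∧ ∀ j, |θ.1 j - β j| ≤ √θ.2 * ρ}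

theorem measurableSet_nearBox {p : ℕ} (β : Fin p → ℝ) (t₁ t₂ ρ : ℝ) :
    MeasurableSet (nearBox β t₁ t₂ ρ) := by
  have : nearBox β t₁ t₂ ρ = Prod.snd ⁻¹' Set.Icc t₁ t₂ ∩
      ⋂ j, {θ : (Fin p → ℝ) × ℝ | |θ.1 j - β j| ≤ √θ.2 * ρ} := by
    ext θ; simp [nearBox]
  rw [this]
  exact (measurable_snd measurableSet_Icc).inter
    (MeasurableSet.iInter fun j => measurableSet_le (by fun_prop) (by fun_prop))

/-- Each nonzero coordinate pays length times density, 2ρδ. The zero coordinates jointly keep mass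
at least (1 - q)^p ≥ 1 - pq ≥ 1/2 by Bernoulli's inequality, so they do not pay for the dimension p.
-/
theorem le_pi_coordLaw_box (hg0 : ∀ x, 0 ≤ g x) (hg1 : ∫ x, g x = 1) {p : ℕ} (m : Fin p → ℝ)
    {ρ δ q : ℝ} (hρ : 0 ≤ ρ) (hδ0 : 0 ≤ δ) (hq0 : 0 ≤ q) (hpq : p * q ≤ 1 / 2)
    (hq : 1 - ∫ x in Set.Icc (-ρ) ρ, g x ≤ q)
    (hδ : ∀ j, m j ≠ 0 → ∀ x ∈ Set.Icc (m j - ρ) (m j + ρ), δ ≤ g x) :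
    ENNReal.ofReal ((2 * ρ * δ) ^ sparsity m / 2) ≤
      Measure.pi (fun _ : Fin p => coordLaw g) {x | ∀ j, |x j - m j| ≤ ρ} := by
  have := isProbabilityMeasure_coordLaw hg0 hg1
  have h : {x : Fin p → ℝ | ∀ j, |x j - m j| ≤ ρ} =
      Set.univ.pi fun j => Set.Icc (m j - ρ) (m j + ρ) := by
    ext x
    simp only [Set.mem_ofPred_eq, Set.mem_univ_pi, Set.mem_Icc, abs_le]
    refine forall_congr' fun j => ?_
    constructor <;> rintro ⟨h1, h2⟩ <;> constructor <;> linarith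
  rw [h, Measure.pi_pi]
  rcases Nat.eq_zero_or_pos p with rfl | hp
  · simp [sparsity]
  have hp1 : (1 : ℝ) ≤ p := by exact_mod_cast hp
  have hq1 : q ≤ 1 / 2 := by nlinarith
  have hb : 1 / 2 ≤ (1 - q) ^ p := by
    have := one_add_mul_le_pow (a := -q) (by linarith) p
    calc (1 / 2 : ℝ) ≤ 1 + p * -q := by linarith
      _ ≤ _ := by rw [sub_eq_add_neg]; exact this
  calc ENNReal.ofReal ((2 * ρ * δ) ^ sparsity m / 2)
      ≤ ENNReal.ofReal (∏ j, if m j ≠ 0 then 2 * ρ * δ else 1 - q) := by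
        refine ENNReal.ofReal_le_ofReal ?_
        rw [Finset.prod_ite, Finset.prod_const, Finset.prod_const, div_eq_mul_one_div]
        refine mul_le_mul le_rfl (hb.trans ?_) (by norm_num) (by positivity)
        refine pow_le_pow_of_le_one (by linarith) (by linarith) ?_
        exact (Finset.card_le_univ _).trans (by simp)
    _ = ∏ j, ENNReal.ofReal (if m j ≠ 0 then 2 * ρ * δ else 1 - q) := by
        rw [ENNReal.ofReal_prod_of_nonneg]
        intro j _
        split_ifs
        · positivity
        · linarith
    _ ≤ _ := by
        refine Finset.prod_le_prod' fun j _ => ?_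
        split_ifs with hj
        · refine le_trans (ENNReal.ofReal_le_ofReal (le_of_eq ?_)) (le_coordLaw_Icc hδ0 (hδ j hj))
          ring
        · have hj' : m j = 0 := by simpa using hj
          rw [hj', zero_sub, zero_add, coordLaw_Icc hg0 hg1]
          exact ENNReal.ofReal_le_ofReal (by linarith)

theorem le_priorMeasure_nearBox (ha : 0 < a₀) (hb : 0 < b₀) (hgm : Measurable g)
    (hg0 : ∀ x, 0 ≤ g x) (hg1 : ∫ x, g x = 1) {p : ℕ} (β : Fin p → ℝ) {t₁ t₂ ρ δ q κ : ℝ}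
    (ht₁ : 0 < t₁) (hρ : 0 ≤ ρ) (hδ0 : 0 ≤ δ) (hq0 : 0 ≤ q) (hpq : p * q ≤ 1 / 2)
    (hq : 1 - ∫ x in Set.Icc (-ρ) ρ, g x ≤ q)
    (hδ : ∀ t ∈ Set.Icc t₁ t₂, ∀ j, ∀ x ∈ Set.Icc (β j / √t - ρ) (β j / √t + ρ), δ ≤ g x)
    (hκ : ∀ t ∈ Set.Icc t₁ t₂, κ ≤ invGammaPDF a₀ b₀ t) (hκ0 : 0 ≤ κ) :
    ENNReal.ofReal (κ * (t₂ - t₁) * ((2 * ρ * δ) ^ sparsity β / 2)) ≤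
      priorMeasure a₀ b₀ g p (nearBox β t₁ t₂ ρ) := by
  rw [priorMeasure_apply ha hb hgm hg0 hg1 p (measurableSet_nearBox β t₁ t₂ ρ)]
  calc ENNReal.ofReal (κ * (t₂ - t₁) * ((2 * ρ * δ) ^ sparsity β / 2))
      = ∫⁻ t in Set.Icc t₁ t₂, ENNReal.ofReal κ * ENNReal.ofReal ((2 * ρ * δ) ^ sparsity β / 2) := by
        rw [setLIntegral_const, Real.volume_Icc, ENNReal.ofReal_mul' (by positivity),
          ENNReal.ofReal_mul hκ0]
        ring
    _ ≤ ∫⁻ t in Set.Icc t₁ t₂, ENNReal.ofReal (invGammaPDF a₀ b₀ t) *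
      (Measure.pi fun _ : Fin p => coordLaw g) {x | (√t • x, t) ∈ nearBox β t₁ t₂ ρ} := by
        refine setLIntegral_mono' measurableSet_Icc fun t ht => ?_
        have ht0 : 0 < t := ht₁.trans_le ht.1
        have hc : 0 < √t := Real.sqrt_pos.2 ht0
        refine mul_le_mul' (ENNReal.ofReal_le_ofReal (hκ t ht)) ?_
        have hs : sparsity β = sparsity fun j => β j / √t := by
          simp [sparsity, hc.ne']
        have hset : {x : Fin p → ℝ | (√t • x, t) ∈ nearBox β t₁ t₂ ρ} =
            {x | ∀ j, |x j - β j / √t| ≤ ρ} := by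
          ext x
          simp only [nearBox, Set.mem_ofPred_eq, ht, true_and, Pi.smul_apply, smul_eq_mul]
          refine forall_congr' fun j => ?_
          have : √t * x j - β j = √t * (x j - β j / √t) := by field_simp
          rw [this, abs_mul, abs_of_pos hc, mul_le_mul_iff_right₀ hc]
        rw [hs, hset]
        exact le_pi_coordLaw_box hg0 hg1 _ hρ hδ0 hq0 hpq hq fun j _ => hδ t ht j
    _ ≤ _ := setLIntegral_le_lintegral _ _

end Prior

/-! ### Chi-square deviations and projections of Gaussian noise. -/

theorem lintegral_exp_mul_sq_gaussianReal {c : ℝ} (hc : c < 1 / 2) :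
    ∫⁻ x, ENNReal.ofReal (Real.exp (c * x ^ 2)) ∂(gaussianReal 0 1) =
      ENNReal.ofReal √(1 / (1 - 2 * c)) := by
  have hb : 0 < 1 / 2 - c := by linarith
  have hm : Measurable fun x : ℝ => ENNReal.ofReal (Real.exp (c * x ^ 2)) := by fun_prop
  rw [gaussianReal_of_var_ne_zero _ one_ne_zero,
    lintegral_withDensity_eq_lintegral_mul _ (measurable_gaussianPDF 0 1) hm]
  have h : ∀ x : ℝ, (gaussianPDF 0 1 * fun x => ENNReal.ofReal (Real.exp (c * x ^ 2))) x =
      ENNReal.ofReal ((√(2 * Real.pi))⁻¹ * Real.exp (-(1 / 2 - c) * x ^ 2)) := fun x => by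
    rw [Pi.mul_apply, gaussianPDF, ← ENNReal.ofReal_mul (gaussianPDFReal_nonneg _ _ _),
      gaussianPDFReal, mul_assoc, ← Real.exp_add]
    congr 2
    · simp
    · congr 1
      simp
      ring
  simp_rw [h]
  rw [← ofReal_integral_eq_lintegral_ofReal ((integrable_exp_neg_mul_sq hb).const_mul _)
    (ae_of_all _ fun x => by positivity), integral_const_mul, integral_gaussian]
  congr 1
  rw [← Real.sqrt_inv, ← Real.sqrt_mul (by positivity)]
  congr 1
  have := Real.pi_pos
  have : 1 - 2 * c ≠ 0 := by linarith
  field_simp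

theorem lintegral_exp_sum_sq_pi_gaussianReal {n : ℕ} (s : Finset (Fin n)) {c : ℝ}
    (hc : c < 1 / 2) :
    ∫⁻ x, ENNReal.ofReal (Real.exp (c * ∑ i ∈ s, x i ^ 2))
      ∂(Measure.pi fun _ : Fin n => gaussianReal 0 1) =
      ENNReal.ofReal (√(1 / (1 - 2 * c)) ^ s.card) := by
  have h : ∀ x : Fin n → ℝ, ENNReal.ofReal (Real.exp (c * ∑ i ∈ s, x i ^ 2)) =
      ∏ i, (if i ∈ s then fun y : ℝ => ENNReal.ofReal (Real.exp (c * y ^ 2))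
        else fun _ => 1) (x i) := fun x => by
    rw [Finset.mul_sum, Real.exp_sum, ENNReal.ofReal_prod_of_nonneg fun _ _ => by positivity,
      ← Finset.prod_ite_mem_eq s]
    refine Finset.prod_congr rfl fun i _ => ?_
    split_ifs <;> rfl
  simp_rw [h]
  rw [lintegral_fin_prod _ _ fun i => by split_ifs <;> fun_prop]
  rw [ENNReal.ofReal_pow (by positivity), ← Finset.prod_const, ← Finset.prod_ite_mem_eq s]
  refine Finset.prod_congr rfl fun i _ => ?_
  split_ifs
  · exact lintegral_exp_mul_sq_gaussianReal hc
  · simp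

/-- Markov's inequality for an exponential. -/
theorem measure_le_of_lintegral_exp {Ω : Type*} [MeasurableSpace Ω] (μ : Measure Ω) {f : Ω → ℝ}
    (hf : Measurable f) {T B : ℝ}
    (hB : ∫⁻ x, ENNReal.ofReal (Real.exp (f x)) ∂μ ≤ ENNReal.ofReal B) :
    μ {x | T ≤ f x} ≤ ENNReal.ofReal (B * Real.exp (-T)) := by
  have h := mul_meas_ge_le_lintegral (μ := μ) (f := fun x => ENNReal.ofReal (Real.exp (f x)))
    (by fun_prop) (ENNReal.ofReal (Real.exp T))
  have hs : {x | ENNReal.ofReal (Real.exp T) ≤ ENNReal.ofReal (Real.exp (f x))} =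
      {x | T ≤ f x} := by
    ext x
    simp [ENNReal.ofReal_le_ofReal_iff (Real.exp_pos _).le]
  rw [hs] at h
  rw [ENNReal.ofReal_mul' (Real.exp_pos _).le, Real.exp_neg,
    ENNReal.ofReal_inv_of_pos (Real.exp_pos _), ← div_eq_mul_inv,
    ENNReal.le_div_iff_mul_le (Or.inl (by simpa using Real.exp_pos T))
      (Or.inl ENNReal.ofReal_ne_top), mul_comm]
  exact h.trans hB

theorem pi_gaussianReal_sum_sq_ge_le (n : ℕ) :
    (Measure.pi fun _ : Fin n => gaussianReal 0 1) {e | 2 * n ≤ ∑ i, e i ^ 2} ≤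
      ENNReal.ofReal (Real.exp (-(1 - Real.log 2) / 2 * n)) := by
  -- The exponent 1/4 is the optimal Chernoff parameter for the threshold 2n.
  have h := lintegral_exp_sum_sq_pi_gaussianReal (Finset.univ : Finset (Fin n))
    (c := 1 / 4) (by norm_num)
  have h' := measure_le_of_lintegral_exp (T := 1 / 4 * (2 * n)) _ (by fun_prop) h.le
  have hset : {e : Fin n → ℝ | 2 * (n : ℝ) ≤ ∑ i, e i ^ 2} =
      {e | 1 / 4 * (2 * (n : ℝ)) ≤ 1 / 4 * ∑ i, e i ^ 2} := by
    ext e; simp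
  rw [hset]
  refine h'.trans (ENNReal.ofReal_le_ofReal (le_of_eq ?_))
  have h2 : √(1 / (1 - 2 * (1 / 4)) : ℝ) = Real.exp (Real.log 2 / 2) := by
    rw [show (1 / (1 - 2 * (1 / 4)) : ℝ) = 2 by norm_num, Real.exp_half, Real.exp_log two_pos]
  rw [h2, ← Real.exp_nat_mul, ← Real.exp_add, Finset.card_univ, Fintype.card_fin]
  congr 1
  ring

theorem pi_gaussianReal_sum_sq_le_le {κ : ℝ} (h0 : 0 < κ) (h1 : κ ≤ 1) (n : ℕ) :
    (Measure.pi fun _ : Fin n => gaussianReal 0 1) {e | ∑ i, e i ^ 2 ≤ κ * n} ≤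
      ENNReal.ofReal (Real.exp (-(κ - 1 - Real.log κ) / 2 * n)) := by
  -- Optimal Chernoff parameter for the threshold κn; it is nonpositive, as a lower tail requires.
  set c : ℝ := (1 - κ⁻¹) / 2
  have hk : 0 < κ⁻¹ := inv_pos.2 h0
  have hc : 1 - 2 * c = κ⁻¹ := by simp only [c]; ring
  have hk1 : 1 ≤ κ⁻¹ := (one_le_inv₀ h0).2 h1
  have hc0 : c ≤ 0 := by simp only [c]; linarith
  have h := lintegral_exp_sum_sq_pi_gaussianReal (Finset.univ : Finset (Fin n))
    (c := c) (by linarith)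
  have h' := measure_le_of_lintegral_exp (T := c * (κ * n)) _ (by fun_prop) h.le
  refine (measure_mono fun e he => ?_).trans
    (h'.trans (ENNReal.ofReal_le_ofReal (le_of_eq ?_)))
  · exact mul_le_mul_of_nonpos_left he hc0
  have h2 : √(1 / (1 - 2 * c) : ℝ) = Real.exp (Real.log κ / 2) := by
    rw [hc, one_div, inv_inv, Real.exp_half, Real.exp_log h0]
  rw [h2, ← Real.exp_nat_mul, ← Real.exp_add, Finset.card_univ, Fintype.card_fin]
  congr 1
  have : c * κ = (κ - 1) / 2 := by simp only [c]; field_simp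
  rw [← mul_assoc, this]
  ring

/-- An orthonormal basis of S extends to the whole space, in which the noise again has i.i.d.
standard coordinates. By Cauchy–Schwarz a violating v forces the squared norm of the projection on S
above T, and its exponential moment at 1/4 is √2 per dimension. -/
theorem pi_gaussianReal_subspace_le {n k : ℕ} (S : Submodule ℝ (EuclideanSpace ℝ (Fin n)))
    (hk : Module.finrank ℝ S ≤ k) (T : ℝ) :
    (Measure.pi fun _ : Fin n => gaussianReal 0 1)
      {e | ∃ v ∈ S, T * ‖v‖ ^ 2 < ⟪WithLp.toLp 2 e, v⟫ ^ 2} ≤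
      ENNReal.ofReal (√2 ^ k * Real.exp (-(T / 4))) := by
  set d := Module.finrank ℝ S
  set u := stdOrthonormalBasis ℝ S
  have hd : d ≤ n := by simpa using S.finrank_le
  let w : Fin n → EuclideanSpace ℝ (Fin n) := fun i => if h : (i : ℕ) < d then u ⟨i, h⟩ else 0
  have hw : Orthonormal ℝ (({i : Fin n | (i : ℕ) < d} : Set (Fin n)).domRestrict w) := by
    have h1 : ({i : Fin n | (i : ℕ) < d} : Set (Fin n)).domRestrict w =
        fun i => S.subtypeₗᵢ (u ⟨i.1, i.2⟩) := by
      ext1 i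
      have := i.2
      simp only [Set.mem_ofPred_eq] at this
      simp [w, Set.domRestrict, this]
    rw [h1]
    have h2 := u.orthonormal.comp_linearIsometry S.subtypeₗᵢ
    exact h2.comp (fun i : {i : Fin n | (i : ℕ) < d} => (⟨i.1, i.2⟩ : Fin d))
      (fun i j hij => by ext; simpa using hij)
  obtain ⟨b, hb⟩ := hw.exists_orthonormalBasis_extension_of_card_eq (by simp)
  have hbu : ∀ l : Fin d, b (Fin.castLE hd l) = u l := fun l => by
    rw [hb _ (by simp)]; simp [w]
  let s : Finset (Fin n) := Finset.univ.map (Fin.castLEEmb hd)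
  have hs : s.card = d := by simp [s]
  have key : ∫⁻ e, ENNReal.ofReal (Real.exp (1 / 4 * ∑ l, ⟪WithLp.toLp 2 e, b (Fin.castLE hd l)⟫ ^ 2))
      ∂(Measure.pi fun _ : Fin n => gaussianReal 0 1) ≤ ENNReal.ofReal (√2 ^ k) := by
    let F : EuclideanSpace ℝ (Fin n) → ℝ≥0∞ := fun x =>
      ENNReal.ofReal (Real.exp (1 / 4 * ∑ l, ⟪x, b (Fin.castLE hd l)⟫ ^ 2))
    have hF : Measurable F := by fun_prop
    have h1 : ∫⁻ e, F (WithLp.toLp 2 e) ∂(Measure.pi fun _ : Fin n => gaussianReal 0 1) =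
        ∫⁻ x, F (∑ i, x i • b i) ∂(Measure.pi fun _ : Fin n => gaussianReal 0 1) := by
      rw [← lintegral_map hF (by fun_prop), map_pi_eq_stdGaussian,
        stdGaussian_eq_map_pi_orthonormalBasis b, lintegral_map hF (by fun_prop)]
    have h2 : ∀ x : Fin n → ℝ, F (∑ i, x i • b i) =
        ENNReal.ofReal (Real.exp (1 / 4 * ∑ i ∈ s, x i ^ 2)) := fun x => by
      simp only [F, s, Finset.sum_map, Fin.castLEEmb_apply]
      congr 4
      ext l
      congr 1
      rw [real_inner_comm]
      exact b.orthonormal.inner_right_fintype x _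
    change ∫⁻ e, F (WithLp.toLp 2 e) ∂_ ≤ _
    rw [h1]
    simp_rw [h2]
    rw [lintegral_exp_sum_sq_pi_gaussianReal s (by norm_num), hs]
    refine ENNReal.ofReal_le_ofReal ?_
    rw [show (1 / (1 - 2 * (1 / 4)) : ℝ) = 2 by norm_num]
    exact pow_le_pow_right₀ (by rw [Real.one_le_sqrt]; norm_num) hk
  refine (measure_mono ?_).trans (measure_le_of_lintegral_exp (T := T / 4) _ (by fun_prop) key)
  rintro e ⟨v, hv, hlt⟩
  set v' : S := ⟨v, hv⟩
  have hv1 : v = ∑ l, u.repr v' l • (u l : EuclideanSpace ℝ (Fin n)) := by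
    have := congrArg (Subtype.val) (u.sum_repr v')
    simpa using this.symm
  have hnorm : ‖v‖ ^ 2 = ∑ l, u.repr v' l ^ 2 := by
    have : ‖v‖ = ‖u.repr v'‖ := by rw [LinearIsometryEquiv.norm_map]; rfl
    rw [this, EuclideanSpace.real_norm_sq_eq]
  have hin : ⟪WithLp.toLp 2 e, v⟫ = ∑ l, u.repr v' l * ⟪WithLp.toLp 2 e, b (Fin.castLE hd l)⟫ := by
    conv_lhs => rw [hv1]
    simp [inner_sum, inner_smul_right, hbu]
  have hcs := Finset.sum_mul_sq_le_sq_mul_sq Finset.univ (fun l => u.repr v' l)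
    (fun l => ⟪WithLp.toLp 2 e, b (Fin.castLE hd l)⟫)
  rw [← hin, ← hnorm] at hcs
  have hpos : 0 < ‖v‖ ^ 2 := by
    rcases (sq_nonneg ‖v‖).eq_or_lt with h | h
    · rw [← h] at hlt hcs
      simp only [mul_zero, zero_mul] at hlt hcs
      linarith
    · exact h
  have : T < ∑ l, ⟪WithLp.toLp 2 e, b (Fin.castLE hd l)⟫ ^ 2 := by
    by_contra hcon
    push Not at hcon
    nlinarith
  simp only [Set.mem_ofPred_eq]
  linarith

theorem exists_fin_fun_range_supset {p k : ℕ} (hp : 0 < p) (ξ : Finset (Fin p)) (hξ : ξ.card ≤ k) :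
    ∃ f : Fin k → Fin p, ∀ j ∈ ξ, ∃ l, f l = j := by
  -- Surplus indices are padded with the element 0, which is where p > 0 is needed.
  refine ⟨fun l => if h : (l : ℕ) < ξ.card then (ξ.equivFin.symm ⟨l, h⟩ : Fin p) else ⟨0, hp⟩,
    fun j hj => ?_⟩
  refine ⟨Fin.castLE hξ (ξ.equivFin ⟨j, hj⟩), ?_⟩
  simp

/-- The images of k-sparse vectors lie in the spans of k columns. Choosing the columns by maps `Fin
k → Fin p` gives p ^ k subspaces and covers smaller supports as well. -/
theorem pi_gaussianReal_sparse_le {n p : ℕ} (X : Matrix (Fin n) (Fin p) ℝ) (k : ℕ) (T : ℝ)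
    (hp : 0 < p) :
    (Measure.pi fun _ : Fin n => gaussianReal 0 1)
      {e | ∃ c : Fin p → ℝ, sparsity c ≤ k ∧
        T * l2norm (X.mulVec c) ^ 2 < (e ⬝ᵥ X.mulVec c) ^ 2} ≤
      ENNReal.ofReal ((p * √2) ^ k * Real.exp (-(T / 4))) := by
  let S : (Fin k → Fin p) → Submodule ℝ (EuclideanSpace ℝ (Fin n)) := fun f =>
    Submodule.span ℝ (Set.range fun l => WithLp.toLp 2 (X.col (f l)))
  have hS : ∀ f, Module.finrank ℝ (S f) ≤ k := fun f => by
    refine (finrank_range_le_card (R := ℝ) (fun l => WithLp.toLp 2 (X.col (f l)))).trans ?_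
    simp
  have hsub : {e : Fin n → ℝ | ∃ c : Fin p → ℝ, sparsity c ≤ k ∧
        T * l2norm (X.mulVec c) ^ 2 < (e ⬝ᵥ X.mulVec c) ^ 2} ⊆
      ⋃ f ∈ (Finset.univ : Finset (Fin k → Fin p)),
        {e | ∃ v ∈ S f, T * ‖v‖ ^ 2 < ⟪WithLp.toLp 2 e, v⟫ ^ 2} := by
    rintro e ⟨c, hc, hlt⟩
    obtain ⟨f, hf⟩ := exists_fin_fun_range_supset hp _ hc
    simp only [Set.mem_iUnion]
    refine ⟨f, Finset.mem_univ _, WithLp.toLp 2 (X.mulVec c), ?_, ?_⟩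
    · have : WithLp.toLp 2 (X.mulVec c) = ∑ j, c j • WithLp.toLp 2 (X.col j) := by
        ext i
        simp [Matrix.mulVec, dotProduct, Matrix.col, mul_comm]
      rw [this]
      refine Submodule.sum_mem _ fun j _ => ?_
      by_cases hj : c j = 0
      · simp [hj]
      · obtain ⟨l, rfl⟩ := hf j (by simpa using hj)
        exact Submodule.smul_mem _ _ (Submodule.subset_span ⟨l, rfl⟩)
    · have h : ⟪WithLp.toLp 2 e, WithLp.toLp 2 (X.mulVec c)⟫ = e ⬝ᵥ X.mulVec c := by
        simp [PiLp.inner_apply, dotProduct, mul_comm]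
      rw [h]
      exact hlt
  refine (measure_mono hsub).trans ((measure_biUnion_finset_le _ _).trans ?_)
  refine (Finset.sum_le_sum fun f _ => pi_gaussianReal_subspace_le (S f) (hS f) T).trans ?_
  rw [Finset.sum_const, Finset.card_univ, nsmul_eq_mul, Fintype.card_fun, Fintype.card_fin,
    Fintype.card_fin, ← ENNReal.ofReal_natCast, ← ENNReal.ofReal_mul (by positivity)]
  refine ENNReal.ofReal_le_ofReal (le_of_eq ?_)
  push_cast
  ring

/-! ### Deterministic lower bound on the residuals for good noise. -/

theorem l2norm_add_le {n : ℕ} (v w : Fin n → ℝ) : l2norm (v + w) ≤ l2norm v + l2norm w := by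
  unfold l2norm
  rw [WithLp.toLp_add]
  exact norm_add_le _ _

theorem l2norm_neg {n : ℕ} (v : Fin n → ℝ) : l2norm (-v) = l2norm v := by
  simp [l2norm]

theorem l2norm_smul_sub_sq {n : ℕ} (σ : ℝ) (e w : Fin n → ℝ) :
    l2norm (σ • e - w) ^ 2 = σ ^ 2 * ∑ i, e i ^ 2 - 2 * σ * (e ⬝ᵥ w) + l2norm w ^ 2 := by
  simp only [l2norm_sq, dotProduct, Finset.mul_sum, ← Finset.sum_sub_distrib,
    ← Finset.sum_add_distrib]
  refine Finset.sum_congr rfl fun i _ => ?_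
  simp
  ring

section Design

variable {n p : ℕ} {X : Matrix (Fin n) (Fin p) ℝ}

theorem l2norm_col_le (hX : ∀ i j, |X i j| ≤ 1) (j : Fin p) : l2norm (X.col j) ≤ √n := by
  refine Real.le_sqrt_of_sq_le ?_
  rw [l2norm_sq]
  calc ∑ i, X.col j i ^ 2 ≤ ∑ _i : Fin n, (1 : ℝ) :=
        Finset.sum_le_sum fun i _ => (sq_le_one_iff_abs_le_one _).2 (hX i j)
    _ = n := by simp

theorem mulVec_eq_sum_col (c : Fin p → ℝ) : X.mulVec c = ∑ j, c j • X.col j := by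
  ext i
  simp [Matrix.mulVec, dotProduct, Matrix.col, mul_comm]

theorem l2norm_mulVec_le (hX : ∀ i j, |X i j| ≤ 1) (c : Fin p → ℝ) :
    l2norm (X.mulVec c) ≤ √n * ∑ j, |c j| := by
  have h : WithLp.toLp 2 (X.mulVec c) = ∑ j, c j • WithLp.toLp 2 (X.col j) := by
    rw [mulVec_eq_sum_col, WithLp.toLp_sum]
    rfl
  rw [l2norm, h, Finset.mul_sum]
  refine (norm_sum_le _ _).trans (Finset.sum_le_sum fun j _ => ?_)
  rw [norm_smul, Real.norm_eq_abs, mul_comm]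
  exact mul_le_mul_of_nonneg_right (l2norm_col_le hX j) (abs_nonneg _)

/-- The noise `e` has small correlation with all sparse combinations of the columns of `X`. -/
def SparseNoiseBound (X : Matrix (Fin n) (Fin p) ℝ) (k : ℕ) (T : ℝ) (e : Fin n → ℝ) : Prop :=
  ∀ c : Fin p → ℝ, sparsity c ≤ k → (e ⬝ᵥ X.mulVec c) ^ 2 ≤ T * l2norm (X.mulVec c) ^ 2

theorem SparseNoiseBound.abs_dotProduct_le {k : ℕ} {T : ℝ} {e : Fin n → ℝ} (hT : 0 ≤ T)
    (h : SparseNoiseBound X k T e) {c : Fin p → ℝ} (hc : sparsity c ≤ k) :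
    |e ⬝ᵥ X.mulVec c| ≤ √T * l2norm (X.mulVec c) := by
  rw [← Real.sqrt_sq (l2norm_nonneg (X.mulVec c)), ← Real.sqrt_mul hT]
  exact Real.abs_le_sqrt (h c hc)

/-- Vectors that are not sparse are handled column by column, each column being a 1-sparse
combination of norm at most √n; the price is the ℓ¹ norm. -/
theorem SparseNoiseBound.abs_dotProduct_le_sum {k : ℕ} {T : ℝ} {e : Fin n → ℝ} (hT : 0 ≤ T)
    (h : SparseNoiseBound X k T e) (hk : 1 ≤ k) (hX : ∀ i j, |X i j| ≤ 1) (c : Fin p → ℝ) :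
    |e ⬝ᵥ X.mulVec c| ≤ √T * (√n * ∑ j, |c j|) := by
  have hcol : ∀ j, |e ⬝ᵥ X.col j| ≤ √T * √n := fun j => by
    have h1 : X.mulVec (Pi.single j 1) = X.col j := Matrix.mulVec_single_one X j
    have h2 : sparsity (Pi.single j (1 : ℝ)) ≤ k := by
      refine le_trans ?_ hk
      refine (Finset.card_le_card (t := {j}) fun i hi => ?_).trans (by simp)
      by_contra hij
      simp only [Finset.mem_singleton] at hij
      simp [Pi.single_eq_of_ne hij] at hi
    have h3 := h.abs_dotProduct_le hT h2
    rw [h1] at h3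
    exact h3.trans (mul_le_mul_of_nonneg_left (l2norm_col_le hX j) (Real.sqrt_nonneg _))
  rw [mulVec_eq_sum_col, dotProduct_sum]
  refine (Finset.abs_sum_le_sum_abs _ _).trans ?_
  rw [Finset.mul_sum, Finset.mul_sum]
  refine Finset.sum_le_sum fun j _ => ?_
  rw [dotProduct_smul, smul_eq_mul, abs_mul, ← mul_assoc, mul_comm]
  exact mul_le_mul_of_nonneg_right (hcol j) (abs_nonneg _)

theorem residual_sq (X : Matrix (Fin n) (Fin p) ℝ) (βs β : Fin p → ℝ) (σ : ℝ) (e : Fin n → ℝ) :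
    l2norm (X.mulVec βs + σ • e - X.mulVec β) ^ 2 = σ ^ 2 * ∑ i, e i ^ 2 -
      2 * σ * (e ⬝ᵥ X.mulVec (β - βs)) + l2norm (X.mulVec (β - βs)) ^ 2 := by
  rw [← l2norm_smul_sub_sq, Matrix.mulVec_sub]
  congr 2
  abel

/-- Parameters without too many large coefficients and far from the truth have a large residual
sum of squares. -/
theorem residual_sq_ge {βs β : Fin p → ℝ} {σ T ρ t : ℝ} {e : Fin n → ℝ} {k k' : ℕ}
    (hσ : 0 < σ) (hX : ∀ i j, |X i j| ≤ 1) (hT : 0 ≤ T) (hρ : 0 ≤ ρ)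
    (hN : SparseNoiseBound X k' T e)
    (hk' : 1 ≤ k') (hkk : sparsity βs + k ≤ k') (hθ : (β, t) ∉ manyLarge p k ρ)
    (hW : 2 * (√n * (p * (ρ * √t))) ≤ l2norm (X.mulVec (β - βs)))
    (hD : 8 * σ * √T ≤ l2norm (X.mulVec (β - βs))) :
    σ ^ 2 * ∑ i, e i ^ 2 + l2norm (X.mulVec (β - βs)) ^ 2 / 2 ≤
      l2norm (X.mulVec βs + σ • e - X.mulVec β) ^ 2 := by
  set d := β - βs
  let Lg : Finset (Fin p) := Finset.univ.filter fun j => ρ * √t < |β j|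
  have hLg : Lg.card ≤ k := by
    by_contra hcon
    push Not at hcon
    obtain ⟨ξ, h1, h2⟩ := Finset.exists_subset_card_eq hcon.le
    exact hθ ⟨ξ, h2, fun j hj => by simpa [Lg] using h1 hj⟩
  -- Off ξ the true coefficient is zero and β is small, so d splits into a k'-sparse part v and a
  -- part w with entries at most ρ√t.
  let ξ : Finset (Fin p) := (Finset.univ.filter fun j => βs j ≠ 0) ∪ Lg
  have hξ : ξ.card ≤ k' := ((Finset.card_union_le _ _).trans (Nat.add_le_add_left hLg _)).trans hkk
  let v : Fin p → ℝ := fun j => if j ∈ ξ then d j else 0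
  let w : Fin p → ℝ := fun j => if j ∈ ξ then 0 else d j
  have hdvw : d = v + w := by
    ext j
    simp only [v, w, Pi.add_apply]
    split_ifs <;> simp
  have hv : sparsity v ≤ k' := by
    refine (Finset.card_le_card fun j hj => ?_).trans hξ
    by_contra hj'
    simp [v, hj'] at hj
  have hw : ∑ j, |w j| ≤ p * (ρ * √t) := by
    calc ∑ j, |w j| ≤ ∑ _j : Fin p, ρ * √t := by
          refine Finset.sum_le_sum fun j _ => ?_
          by_cases hj : j ∈ ξ
          · simp only [w, hj, if_true, abs_zero]; positivity
          · have hj2 := hj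
            simp only [ξ, Lg, Finset.mem_union, Finset.mem_filter, Finset.mem_univ, true_and,
              not_or, not_not, not_lt] at hj2
            simp only [w, hj, if_false, d, Pi.sub_apply, hj2.1, sub_zero]
            exact hj2.2
      _ = _ := by simp
  set W := √n * (p * (ρ * √t))
  have hXw : l2norm (X.mulVec w) ≤ W :=
    (l2norm_mulVec_le hX w).trans (mul_le_mul_of_nonneg_left hw (Real.sqrt_nonneg _))
  have hXv : l2norm (X.mulVec v) ≤ l2norm (X.mulVec d) + W := by
    have : X.mulVec v = X.mulVec d + -X.mulVec w := by rw [hdvw, Matrix.mulVec_add]; abel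
    rw [this]
    refine (l2norm_add_le _ _).trans ?_
    rw [l2norm_neg]
    linarith
  have hsT := Real.sqrt_nonneg T
  have hev := hN.abs_dotProduct_le hT hv
  have hew : |e ⬝ᵥ X.mulVec w| ≤ √T * W :=
    (hN.abs_dotProduct_le_sum hT hk' hX w).trans
      (mul_le_mul_of_nonneg_left (mul_le_mul_of_nonneg_left hw (Real.sqrt_nonneg _)) hsT)
  have hed : e ⬝ᵥ X.mulVec d ≤ √T * (2 * l2norm (X.mulVec d)) := by
    have h1 : e ⬝ᵥ X.mulVec d = e ⬝ᵥ X.mulVec v + e ⬝ᵥ X.mulVec w := by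
      conv_lhs => rw [hdvw]
      rw [Matrix.mulVec_add, dotProduct_add]
    rw [h1]
    calc e ⬝ᵥ X.mulVec v + e ⬝ᵥ X.mulVec w ≤ √T * l2norm (X.mulVec v) + √T * W :=
          add_le_add ((le_abs_self _).trans hev) ((le_abs_self _).trans hew)
      _ ≤ √T * (l2norm (X.mulVec d) + W) + √T * W := by gcongr
      _ = √T * (l2norm (X.mulVec d) + 2 * W) := by ring
      _ ≤ √T * (l2norm (X.mulVec d) + l2norm (X.mulVec d)) := by gcongr
      _ = _ := by ring
  rw [residual_sq]
  have hd0 := l2norm_nonneg (X.mulVec d)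
  -- The cross term is at most 4σ√T‖Xd‖; since 8σ√T ≤ ‖Xd‖, it takes at most half of ‖Xd‖².
  have h2 : 2 * σ * (e ⬝ᵥ X.mulVec d) ≤ l2norm (X.mulVec d) ^ 2 / 2 := by
    calc 2 * σ * (e ⬝ᵥ X.mulVec d) ≤ 2 * σ * (√T * (2 * l2norm (X.mulVec d))) := by gcongr
      _ = (8 * σ * √T) * l2norm (X.mulVec d) / 2 := by ring
      _ ≤ l2norm (X.mulVec d) * l2norm (X.mulVec d) / 2 := by gcongr
      _ = _ := by ring
  linarith

end Design

/-! ### The Gaussian likelihood maximized over the variance. -/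

section Likelihood

variable {n p : ℕ} {X : Matrix (Fin n) (Fin p) ℝ}

theorem likelihood_eq_exp (y : Fin n → ℝ) (β : Fin p → ℝ) {t : ℝ} (ht : 0 < t) :
    likelihood X y (β, t) = Real.exp (-(n / 2 * Real.log (2 * Real.pi * t)) -
      l2norm (y - X.mulVec β) ^ 2 / (2 * t)) := by
  have h2 : 0 < 2 * Real.pi * t := by have := Real.pi_pos; positivity
  have h : (√(2 * Real.pi * t))⁻¹ = Real.exp (-(Real.log (2 * Real.pi * t) / 2)) := by
    rw [Real.exp_neg, Real.exp_half, Real.exp_log h2]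
  rw [likelihood, h, ← Real.exp_nat_mul, ← Real.exp_add]
  congr 1
  ring

theorem likelihood_of_nonpos (hn : n ≠ 0) (y : Fin n → ℝ) (β : Fin p → ℝ) {t : ℝ} (ht : t ≤ 0) :
    likelihood X y (β, t) = 0 := by
  have : √(2 * Real.pi * t) = 0 := Real.sqrt_eq_zero_of_nonpos
    (mul_nonpos_of_nonneg_of_nonpos (by positivity) ht)
  simp [likelihood, this, hn]

/-- The maximum over `σ²` of the log-likelihood when the mean residual square is `v`. -/
noncomputable def maxLogLik (n : ℕ) (v : ℝ) : ℝ := -(n / 2 * Real.log (2 * Real.pi * v)) - n / 2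

/-- As a function of t the bound -(n/2) log t - nv/(2t) peaks at t = v; this is log x ≤ x - 1 at x =
v/t. -/
theorem likelihood_le_exp_maxLogLik (hn : n ≠ 0) (y : Fin n → ℝ) (β : Fin p → ℝ) (t : ℝ) {v : ℝ}
    (hv : 0 < v) (h : n * v ≤ l2norm (y - X.mulVec β) ^ 2) :
    likelihood X y (β, t) ≤ Real.exp (maxLogLik n v) := by
  rcases le_or_gt t 0 with ht | ht
  · rw [likelihood_of_nonpos hn y β ht]; positivity
  rw [likelihood_eq_exp y β ht, maxLogLik]
  refine Real.exp_le_exp.2 ?_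
  have hpi := Real.pi_pos
  have h1 : Real.log (2 * Real.pi * v) = Real.log (2 * Real.pi * t) + Real.log (v / t) := by
    rw [← Real.log_mul (by positivity) (by positivity)]
    congr 1
    field_simp
  have h2 := Real.log_le_sub_one_of_pos (div_pos hv ht)
  have h3 : n * v / (2 * t) ≤ l2norm (y - X.mulVec β) ^ 2 / (2 * t) := by gcongr
  have h4 : n * v / (2 * t) = n / 2 * (v / t) := by field_simp
  have h5 : (n / 2 : ℝ) * Real.log (v / t) ≤ n / 2 * (v / t - 1) := by gcongr
  rw [h1]
  linarith

/-- Uses log(1 + x) ≥ x/(1 + x) ≥ x/2 on [0, 1]. -/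
theorem maxLogLik_mul_one_add_le {v x : ℝ} (hv : 0 < v) (hx : 0 ≤ x) (hx1 : x ≤ 1) :
    maxLogLik n (v * (1 + x)) ≤ maxLogLik n v - n * x / 4 := by
  have hpi := Real.pi_pos
  have h1 : Real.log (2 * Real.pi * (v * (1 + x))) =
      Real.log (2 * Real.pi * v) + Real.log (1 + x) := by
    rw [← Real.log_mul (by positivity) (by positivity)]
    congr 1
    ring
  have h2 := Real.one_sub_inv_le_log_of_pos (by positivity : 0 < 1 + x)
  have h3 : x / 2 ≤ 1 - (1 + x)⁻¹ := by
    rw [le_sub_iff_add_le, ← le_sub_iff_add_le', inv_le_iff_one_le_mul₀ (by positivity)]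
    nlinarith
  have h4 : (n / 2 : ℝ) * (x / 2) ≤ n / 2 * Real.log (1 + x) := by
    gcongr
    linarith
  rw [maxLogLik, maxLogLik, h1]
  linarith

/-- Dropping the exponential factor, the normalization alone suffices: log t exceeds log v by at
least 5 - 1 = 4, a loss of 2n, of which n/2 covers the term in `maxLogLik`. -/
theorem likelihood_le_of_large_variance (y : Fin n → ℝ) (β : Fin p → ℝ) {t v s : ℝ} (hv : 0 < v)
    (hs : 0 < s) (hvs : v ≤ 2 * s) (ht : Real.exp 5 * s ≤ t) :
    likelihood X y (β, t) ≤ Real.exp (maxLogLik n v - n) := by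
  have ht0 : 0 < t := lt_of_lt_of_le (by positivity) ht
  have hpi := Real.pi_pos
  rw [likelihood_eq_exp y β ht0, maxLogLik]
  refine Real.exp_le_exp.2 ?_
  have h1 : Real.log (2 * Real.pi * s) + 5 ≤ Real.log (2 * Real.pi * t) := by
    rw [← Real.log_exp 5, ← Real.log_mul (by positivity) (by positivity)]
    refine Real.log_le_log (by positivity) ?_
    nlinarith
  have h2 : Real.log (2 * Real.pi * v) ≤ Real.log (2 * Real.pi * s) + 1 := by
    rw [← Real.log_exp 1, ← Real.log_mul (by positivity) (by positivity)]
    refine Real.log_le_log (by positivity) ?_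
    have := Real.add_one_le_exp 1
    nlinarith [mul_pos hpi hs]
  have h3 : 0 ≤ l2norm (y - X.mulVec β) ^ 2 / (2 * t) := by positivity
  have h4 : (n / 2 : ℝ) * (Real.log (2 * Real.pi * v) + 4) ≤
      n / 2 * Real.log (2 * Real.pi * t) := by
    gcongr
    linarith
  linarith

/-- The variance window starts at v, so nv/(2t) stays below n/2 and only the logarithm costs, by
nτ/2. The other two losses are the cross term, through σ/√t ≤ 1/√κ, and the squared displacement of
the mean. -/
theorem le_likelihood_of_mem_nearBox {βs β : Fin p → ℝ} {σ T ρ t κ τ v : ℝ} {e : Fin n → ℝ}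
    {k' : ℕ} (hn : n ≠ 0) (hσ : 0 < σ) (hX : ∀ i j, |X i j| ≤ 1) (hT : 0 ≤ T) (hρ : 0 ≤ ρ)
    (hN : SparseNoiseBound X k' T e) (hk' : 1 ≤ k') (hκ : 0 < κ) (hτ : 0 ≤ τ)
    (hv : n * v = σ ^ 2 * ∑ i, e i ^ 2)
    (hκv : κ * σ ^ 2 ≤ v) (hθ : (β, t) ∈ nearBox βs v (v * (1 + τ)) ρ) :
    Real.exp (maxLogLik n v - (n * τ / 2 + √T * (√n * (p * ρ)) / √κ + (√n * (p * ρ)) ^ 2 / 2)) ≤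
      likelihood X (X.mulVec βs + σ • e) (β, t) := by
  obtain ⟨⟨ht1, ht2⟩, hd⟩ := hθ
  simp only at ht1 ht2 hd
  have hv0 : 0 < v := lt_of_lt_of_le (by positivity) hκv
  have ht : 0 < t := hv0.trans_le ht1
  have hpi := Real.pi_pos
  rw [likelihood_eq_exp _ β ht, maxLogLik]
  refine Real.exp_le_exp.2 ?_
  set ω := √n * (p * ρ)
  have hω : 0 ≤ ω := by positivity
  have hsum : √n * ∑ j, |(β - βs) j| ≤ ω * √t := by
    have : ∑ j, |(β - βs) j| ≤ ∑ _j : Fin p, √t * ρ := Finset.sum_le_sum fun j _ => hd j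
    calc √n * ∑ j, |(β - βs) j| ≤ √n * ∑ _j : Fin p, √t * ρ := by gcongr
      _ = _ := by simp [ω]; ring
  have h1 := (hN.abs_dotProduct_le_sum hT hk' hX (β - βs)).trans
    (mul_le_mul_of_nonneg_left hsum (Real.sqrt_nonneg T))
  have h2 := (l2norm_mulVec_le hX (β - βs)).trans hsum
  have hst : 0 < √t := Real.sqrt_pos.2 ht
  have htt : √t * √t = t := Real.mul_self_sqrt ht.le
  have hRSS : l2norm (X.mulVec βs + σ • e - X.mulVec β) ^ 2 ≤
      n * v + 2 * σ * (√T * (ω * √t)) + (ω * √t) ^ 2 := by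
    rw [residual_sq, hv]
    have h3 := neg_le_of_abs_le h1
    have h4 : l2norm (X.mulVec (β - βs)) ^ 2 ≤ (ω * √t) ^ 2 := by
      have := l2norm_nonneg (X.mulVec (β - βs))
      gcongr
    nlinarith
  have h5 : l2norm (X.mulVec βs + σ • e - X.mulVec β) ^ 2 / (2 * t) ≤
      n / 2 + √T * ω / √κ + ω ^ 2 / 2 := by
    calc _ ≤ (n * v + 2 * σ * (√T * (ω * √t)) + (ω * √t) ^ 2) / (2 * t) := by gcongr
      _ = n / 2 * (v / t) + √T * ω * (σ / √t) + ω ^ 2 / 2 := by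
        have : t = √t ^ 2 := by rw [sq, htt]
        generalize √t = r at *
        subst this
        field_simp
      _ ≤ n / 2 * 1 + √T * ω * (1 / √κ) + ω ^ 2 / 2 := by
        have hσt : σ / √t ≤ 1 / √κ := by
          rw [div_le_div_iff₀ hst (Real.sqrt_pos.2 hκ), one_mul]
          refine Real.le_sqrt_of_sq_le ?_
          rw [mul_pow, Real.sq_sqrt hκ.le]
          linarith
        have hvt : v / t ≤ 1 := (div_le_one ht).2 ht1
        gcongr
      _ = _ := by ring
  have h6 : Real.log (2 * Real.pi * t) ≤ Real.log (2 * Real.pi * v) + τ := by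
    have h7 : Real.log (2 * Real.pi * t) ≤ Real.log (2 * Real.pi * v * (1 + τ)) := by
      refine Real.log_le_log (by positivity) ?_
      rw [mul_assoc _ v]
      gcongr
    rw [Real.log_mul (x := 2 * Real.pi * v) (by positivity) (by positivity)] at h7
    have := Real.log_le_sub_one_of_pos (by positivity : 0 < 1 + τ)
    linarith
  have h8 : (n / 2 : ℝ) * Real.log (2 * Real.pi * t) ≤
      n / 2 * (Real.log (2 * Real.pi * v) + τ) := by gcongr
  linarith

end Likelihood

/-! ### The posterior mass of the bad set for one good noise vector. -/

section Posterior

variable {n p : ℕ} {X : Matrix (Fin n) (Fin p) ℝ} {a₀ b₀ : ℝ} {g : ℝ → ℝ}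

theorem unnormalizedPosterior_le_of_forall_le (hgm : Measurable g) (y : Fin n → ℝ)
    {A : Set ((Fin p → ℝ) × ℝ)} {c Cπ : ℝ} (hc : 0 ≤ c)
    (hA : ∀ θ ∈ A, likelihood X y θ ≤ c)
    (hπ : priorMeasure a₀ b₀ g p Set.univ ≤ ENNReal.ofReal Cπ) :
    unnormalizedPosterior a₀ b₀ g X y A ≤ ENNReal.ofReal (c * Cπ) := by
  rw [unnormalizedPosterior_apply hgm, ENNReal.ofReal_mul hc]
  calc ∫⁻ θ in A, ENNReal.ofReal (likelihood X y θ) ∂priorMeasure a₀ b₀ g p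
      ≤ ∫⁻ _ in A, ENNReal.ofReal c ∂priorMeasure a₀ b₀ g p :=
        setLIntegral_mono measurable_const fun θ hθ => ENNReal.ofReal_le_ofReal (hA θ hθ)
    _ = ENNReal.ofReal c * priorMeasure a₀ b₀ g p A := setLIntegral_const _ _
    _ ≤ _ := by
        gcongr
        exact (measure_mono (Set.subset_univ A)).trans hπ

theorem le_unnormalizedPosterior_of_forall_le (hgm : Measurable g) (y : Fin n → ℝ)
    {A : Set ((Fin p → ℝ) × ℝ)} (hAm : MeasurableSet A) {c m : ℝ} (hc : 0 ≤ c)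
    (hA : ∀ θ ∈ A, c ≤ likelihood X y θ)
    (hm : ENNReal.ofReal m ≤ priorMeasure a₀ b₀ g p A) :
    ENNReal.ofReal (c * m) ≤ unnormalizedPosterior a₀ b₀ g X y A := by
  rw [unnormalizedPosterior_apply hgm, ENNReal.ofReal_mul hc]
  calc ENNReal.ofReal c * ENNReal.ofReal m
      ≤ ENNReal.ofReal c * priorMeasure a₀ b₀ g p A := by gcongr
    _ = ∫⁻ _ in A, ENNReal.ofReal c ∂priorMeasure a₀ b₀ g p := (setLIntegral_const _ _).symm
    _ ≤ _ := setLIntegral_mono' hAm fun θ hθ => ENNReal.ofReal_le_ofReal (hA θ hθ)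

/-- The first exponential is the inverse of the evidence bound; the three summands are large
variance, many large coefficients, and large residual. The factor `exp (maxLogLik n v)` cancels from
the ratio. -/
theorem posterior_le {βs : Fin p → ℝ} {σ T ρ κ τ x h₂ Cπ D : ℝ} {e : Fin n → ℝ}
    {k k' : ℕ} (hn : n ≠ 0) (hσ : 0 < σ) (hX : ∀ i j, |X i j| ≤ 1) (hgm : Measurable g)
    (hT : 0 ≤ T) (hρ : 0 ≤ ρ) (hN : SparseNoiseBound X k' T e) (hk' : 1 ≤ k')
    (hkk : sparsity βs + k ≤ k') (hκ : 0 < κ) (hτ : 0 ≤ τ)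
    (hQ₁ : κ * n ≤ ∑ i, e i ^ 2) (hQ₂ : ∑ i, e i ^ 2 ≤ 2 * n)
    (hB : unnormalizedPosterior a₀ b₀ g X (X.mulVec βs + σ • e) (manyLarge p k ρ) ≤
      ENNReal.ofReal (Real.exp (-x) * likelihood X (X.mulVec βs + σ • e) (βs, σ ^ 2)))
    (hbox : ENNReal.ofReal (Real.exp (-h₂)) ≤ priorMeasure a₀ b₀ g p
      (nearBox βs (σ ^ 2 * (∑ i, e i ^ 2) / n) (σ ^ 2 * (∑ i, e i ^ 2) / n * (1 + τ)) ρ))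
    (hCπ : 0 ≤ Cπ) (hπ : priorMeasure a₀ b₀ g p Set.univ ≤ ENNReal.ofReal Cπ)
    (hD0 : 0 ≤ D) (hD₁ : 2 * (√n * (p * ρ)) * (Real.exp (5 / 2) * σ) ≤ D)
    (hD₂ : 8 * σ * √T ≤ D) (hD₃ : D ^ 2 ≤ 4 * σ ^ 2 * n) :
    posterior a₀ b₀ g X (X.mulVec βs + σ • e)
        {θ | D ≤ l2norm (X.mulVec θ.1 - X.mulVec βs)} ≤
      ENNReal.ofReal (Real.exp (n * τ / 2 + √T * (√n * (p * ρ)) / √κ + (√n * (p * ρ)) ^ 2 / 2 + h₂) *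
        (Cπ * Real.exp (-n) + Real.exp (-x) + Cπ * Real.exp (-(D ^ 2 / (16 * σ ^ 2))))) := by
  have hn0 : (0 : ℝ) < n := by exact_mod_cast Nat.pos_of_ne_zero hn
  set Q := ∑ i, e i ^ 2
  set v := σ ^ 2 * Q / n with hvdef
  set y := X.mulVec βs + σ • e
  set h := n * τ / 2 + √T * (√n * (p * ρ)) / √κ + (√n * (p * ρ)) ^ 2 / 2
  set gM := maxLogLik n v
  have hnv : n * v = σ ^ 2 * Q := by rw [hvdef]; field_simp
  have hQ0 : 0 < Q := lt_of_lt_of_le (by positivity) hQ₁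
  have hκv : κ * σ ^ 2 ≤ v := by
    rw [hvdef, le_div_iff₀ hn0]
    nlinarith [sq_pos_of_pos hσ]
  have hv0 : 0 < v := by positivity
  have hv2 : v ≤ 2 * σ ^ 2 := by
    rw [hvdef, div_le_iff₀ hn0]
    nlinarith [sq_pos_of_pos hσ]
  set U := unnormalizedPosterior a₀ b₀ g X y
  have hZ : ENNReal.ofReal (Real.exp (gM - h) * Real.exp (-h₂)) ≤ U Set.univ := by
    refine (le_unnormalizedPosterior_of_forall_le hgm y (measurableSet_nearBox βs v _ ρ)
      (Real.exp_pos _).le ?_ hbox).trans (measure_mono (Set.subset_univ _))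
    rintro ⟨β, t⟩ hθ
    exact le_likelihood_of_mem_nearBox hn hσ hX hT hρ hN hk' hκ hτ hnv hκv hθ
  set A := {θ : (Fin p → ℝ) × ℝ | D ≤ l2norm (X.mulVec θ.1 - X.mulVec βs)}
  have hA1 : U {θ | Real.exp 5 * σ ^ 2 ≤ θ.2} ≤ ENNReal.ofReal (Real.exp (gM - n) * Cπ) := by
    refine unnormalizedPosterior_le_of_forall_le hgm y (Real.exp_pos _).le ?_ hπ
    rintro ⟨β, t⟩ ht
    exact likelihood_le_of_large_variance y β hv0 (by positivity) hv2 ht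
  have hres : l2norm (y - X.mulVec βs) ^ 2 = n * v := by
    rw [residual_sq, sub_self, hnv]
    simp [l2norm, Q]
  have hA2 : U (manyLarge p k ρ) ≤ ENNReal.ofReal (Real.exp (-x) * Real.exp gM) := by
    refine hB.trans (ENNReal.ofReal_le_ofReal ?_)
    gcongr
    exact likelihood_le_exp_maxLogLik hn y βs _ hv0 hres.ge
  -- Relative growth of the residual: with Q ≤ 2n the increase σ²Qx₀ is at most D²/2, and the
  -- resulting gain nx₀/4 is D²/(16σ²). The bound on D² gives x₀ ≤ 1.
  set x₀ := D ^ 2 / (4 * σ ^ 2 * n)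
  have hA3 : U {θ | θ ∈ A ∧ θ ∉ manyLarge p k ρ ∧ θ.2 < Real.exp 5 * σ ^ 2} ≤
      ENNReal.ofReal (Real.exp (gM - n * x₀ / 4) * Cπ) := by
    refine unnormalizedPosterior_le_of_forall_le hgm y (Real.exp_pos _).le ?_ hπ
    rintro ⟨β, t⟩ ⟨hA, hnl, ht⟩
    have hA' : D ≤ l2norm (X.mulVec (β - βs)) := by rw [Matrix.mulVec_sub]; exact hA
    have hx0 : 0 ≤ x₀ := by positivity
    refine (likelihood_le_exp_maxLogLik hn y β t (v := v * (1 + x₀)) (by positivity) ?_).trans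
      (Real.exp_le_exp.2 (maxLogLik_mul_one_add_le hv0 hx0 ?_))
    · refine le_trans ?_ (residual_sq_ge hσ hX hT hρ hN hk' hkk hnl ?_ (hD₂.trans hA'))
      · have h1 : n * (v * (1 + x₀)) = σ ^ 2 * Q + σ ^ 2 * Q * x₀ := by rw [← hnv]; ring
        have h2 : σ ^ 2 * Q * x₀ ≤ σ ^ 2 * (2 * n) * x₀ := by gcongr
        have h3 : σ ^ 2 * (2 * n) * x₀ = D ^ 2 / 2 := by simp only [x₀]; field_simp; ring
        have h4 : D ^ 2 ≤ l2norm (X.mulVec (β - βs)) ^ 2 := by gcongr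
        rw [h1]
        linarith
      · refine le_trans ?_ (hD₁.trans hA')
        have ht' : √t ≤ Real.exp (5 / 2) * σ := by
          refine Real.sqrt_le_iff.2 ⟨by positivity, ?_⟩
          rw [mul_pow, ← Real.exp_nat_mul]
          refine ht.le.trans (le_of_eq ?_)
          norm_num
        calc 2 * (√n * (p * (ρ * √t))) = 2 * (√n * (p * ρ)) * √t := by ring
          _ ≤ _ := by gcongr
    · rw [div_le_one (by positivity)]
      exact hD₃
  have hcover : A ⊆ ({θ | Real.exp 5 * σ ^ 2 ≤ θ.2} ∪ manyLarge p k ρ) ∪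
      {θ | θ ∈ A ∧ θ ∉ manyLarge p k ρ ∧ θ.2 < Real.exp 5 * σ ^ 2} := by
    intro θ hθ
    by_cases h1 : Real.exp 5 * σ ^ 2 ≤ θ.2
    · exact Or.inl (Or.inl h1)
    · by_cases h2 : θ ∈ manyLarge p k ρ
      · exact Or.inl (Or.inr h2)
      · exact Or.inr ⟨hθ, h2, not_le.1 h1⟩
  have hUA : U A ≤ ENNReal.ofReal (Real.exp (gM - n) * Cπ + Real.exp (-x) * Real.exp gM +
      Real.exp (gM - n * x₀ / 4) * Cπ) := by
    rw [ENNReal.ofReal_add (by positivity) (by positivity),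
      ENNReal.ofReal_add (by positivity) (by positivity)]
    refine (measure_mono hcover).trans ((measure_union_le _ _).trans ?_)
    exact add_le_add ((measure_union_le _ _).trans (add_le_add hA1 hA2)) hA3
  have hpost : posterior a₀ b₀ g X y A = (U Set.univ)⁻¹ * U A := rfl
  rw [hpost]
  refine (mul_le_mul' (ENNReal.inv_le_inv.2 hZ) hUA).trans (le_of_eq ?_)
  rw [← ENNReal.ofReal_inv_of_pos (by positivity), ← ENNReal.ofReal_mul (by positivity)]
  congr 1
  have h16 : n * x₀ / 4 = D ^ 2 / (16 * σ ^ 2) := by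
    simp only [x₀]
    field_simp
    ring
  rw [h16, ← Real.exp_add, ← Real.exp_neg, sub_eq_add_neg gM (n : ℝ), sub_eq_add_neg gM (D ^ 2 / _),
    Real.exp_add gM, Real.exp_add gM, show -(gM - h + -h₂) = (h + h₂) + -gM by ring,
    Real.exp_add (h + h₂)]
  have : Real.exp (-gM) * Real.exp gM = 1 := by rw [← Real.exp_add]; simp
  linear_combination (Real.exp (h + h₂) * (Cπ * Real.exp (-n) + Real.exp (-x) +
    Cπ * Real.exp (-(D ^ 2 / (16 * σ ^ 2))))) * this

end Posterior

/-! ### Explicit constants at a fixed sample size. -/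

section FixedSampleSize

variable {n p : ℕ} {X : Matrix (Fin n) (Fin p) ℝ} {a₀ b₀ : ℝ} {g : ℝ → ℝ}

theorem sqrt_mul_baseRate (hn : n ≠ 0) (s : ℕ) :
    √n * baseRate s p n = √(s * Real.log p) := by
  have hn0 : (0 : ℝ) < n := by exact_mod_cast Nat.pos_of_ne_zero hn
  rw [baseRate, ← Real.sqrt_mul hn0.le]
  congr 1
  field_simp

theorem baseRate_sq (s : ℕ) : baseRate s p n ^ 2 = s * Real.log p / n := by
  have : 0 ≤ Real.log p := Real.log_natCast_nonneg p
  exact Real.sq_sqrt (by positivity)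

/-- All factors are bounded below by powers of p: κ₀v/2 by p⁻¹, the window L/n by p⁻² (since n ≤
p²), and each nonzero coordinate by p^{-(2 + Cg)} (since ρ ≥ p⁻²). As log p ≤ L, the exponents add
up to (5 + Cg)L. -/
theorem exp_le_priorMeasure_nearBox {βs : Fin p → ℝ} {σ γ E C Cg u κ κ₀ v : ℝ}
    (ha : 0 < a₀) (hb : 0 < b₀) (hgm : Measurable g) (hg0 : ∀ x, 0 ≤ g x) (hg1 : ∫ x, g x = 1)
    (hn : n ≠ 0) (hp : 2 ≤ p) (hs : 1 ≤ sparsity βs) (hσ : 0 < σ)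
    (hγ0 : 0 < γ) (hγ1 : γ < 1) (hβ : ∀ j, |βs j / σ| ≤ γ * E) (hC : 1 ≤ C)
    (hκ : κ = ((1 + γ) / 2) ^ 2)
    (hconc : 1 - ∫ x in Set.Icc (-(C * baseRate (sparsity βs) p n / p))
      (C * baseRate (sparsity βs) p n / p), g x ≤ (p : ℝ) ^ (-(1 + u)))
    (hpu : (p : ℝ) ^ (-u) ≤ 1 / 2)
    (hρE : C * baseRate (sparsity βs) p n / p ≤ (1 - γ) / (1 + γ) * E)
    (hδ : ∀ x ∈ Set.Icc (-E) E, Real.exp (-(Cg * Real.log p)) ≤ g x)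
    (hnp : (n : ℝ) ≤ p ^ 2) (hL1 : 1 ≤ sparsity βs * Real.log p)
    (hLn : sparsity βs * Real.log p ≤ n)
    (hκ₀ : 0 < κ₀) (hIG : ∀ t ∈ Set.Icc (κ * σ ^ 2) (4 * σ ^ 2), κ₀ ≤ invGammaPDF a₀ b₀ t)
    (hκ₀p : 1 ≤ p * (κ₀ * κ * σ ^ 2 / 2))
    (hv1 : κ * σ ^ 2 ≤ v) (hv2 : v ≤ 2 * σ ^ 2) :
    ENNReal.ofReal (Real.exp (-((5 + Cg) * (sparsity βs * Real.log p)))) ≤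
      priorMeasure a₀ b₀ g p (nearBox βs v (v * (1 + sparsity βs * Real.log p / n))
        (C * baseRate (sparsity βs) p n / p)) := by
  have hn0 : (0 : ℝ) < n := by exact_mod_cast Nat.pos_of_ne_zero hn
  have hp2 : (2 : ℝ) ≤ p := by exact_mod_cast hp
  have hp0 : (0 : ℝ) < p := by linarith
  set s := sparsity βs with hsdef
  have hs1 : (1 : ℝ) ≤ s := by exact_mod_cast hs
  set L := s * Real.log p
  set r := baseRate s p n
  set ρ := C * r / p
  have hr2 : r ^ 2 = L / n := baseRate_sq s
  have hr0 : 0 ≤ r := Real.sqrt_nonneg _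
  have hρ0 : 0 ≤ ρ := by positivity
  have hκpos : 0 < κ := by rw [hκ]; positivity
  have hv0 : 0 < v := lt_of_lt_of_le (by positivity) hv1
  have hlogp : 0 < Real.log p := Real.log_pos (by linarith)
  have hplog : Real.exp (-Real.log p) = (p : ℝ)⁻¹ := by rw [Real.exp_neg, Real.exp_log hp0]
  have hτlow : Real.exp (-(2 * Real.log p)) ≤ L / n := by
    have h1 : Real.exp (-(2 * Real.log p)) = 1 / (p : ℝ) ^ 2 := by
      rw [show -(2 * Real.log p) = (2 : ℕ) * (-Real.log p) by push_cast; ring, Real.exp_nat_mul,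
        hplog]
      field_simp
    rw [h1, div_le_div_iff₀ (by positivity) hn0]
    nlinarith [sq_nonneg (p : ℝ)]
  have hrlow : (p : ℝ)⁻¹ ≤ r := by
    refine (pow_le_pow_iff_left₀ (by positivity) hr0 two_ne_zero).1 ?_
    rw [hr2, ← hplog, ← Real.exp_nat_mul]
    refine le_trans (le_of_eq ?_) hτlow
    congr 1
    push_cast
    ring
  have hρlow : Real.exp (-(2 * Real.log p)) ≤ ρ := by
    have h1 : Real.exp (-(2 * Real.log p)) = (p : ℝ)⁻¹ / p := by
      rw [show -(2 * Real.log p) = -Real.log p + -Real.log p by ring, Real.exp_add, hplog]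
      rfl
    rw [h1]
    simp only [ρ]
    gcongr
    nlinarith
  have hpq : (p : ℝ) * (p : ℝ) ^ (-(1 + u)) ≤ 1 / 2 := by
    refine le_trans (le_of_eq ?_) hpu
    have h := Real.rpow_add hp0 1 (-(1 + u))
    rw [Real.rpow_one] at h
    rw [← h]
    congr 1
    ring
  have hbox := le_priorMeasure_nearBox (κ := κ₀) (t₁ := v) (t₂ := v * (1 + L / n)) (ρ := ρ)
    (δ := Real.exp (-(Cg * Real.log p))) (q := (p : ℝ) ^ (-(1 + u))) ha hb hgm hg0 hg1 βs hv0 hρ0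
    (Real.exp_pos _).le (by positivity) hpq hconc ?_ ?_ hκ₀.le
  · refine le_trans (ENNReal.ofReal_le_ofReal ?_) hbox
    have h1 : Real.exp (-Real.log p) * Real.exp (-(2 * Real.log p)) ≤
        κ₀ * κ * σ ^ 2 / 2 * (L / n) := by
      refine mul_le_mul ?_ hτlow (Real.exp_pos _).le (by positivity)
      rw [hplog, inv_le_iff_one_le_mul₀ hp0, mul_comm]
      exact hκ₀p
    have h2 : Real.exp (-((2 + Cg) * L)) ≤ (2 * ρ * Real.exp (-(Cg * Real.log p))) ^ s := by
      have : -((2 + Cg) * L) = s * (-(2 * Real.log p) + -(Cg * Real.log p)) := by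
        simp only [L]; ring
      rw [this, Real.exp_nat_mul, Real.exp_add]
      gcongr
      linarith
    have hlogL : Real.log p ≤ L := by nlinarith
    calc Real.exp (-((5 + Cg) * L))
        ≤ Real.exp (-Real.log p + -(2 * Real.log p) + -((2 + Cg) * L)) := by
          refine Real.exp_le_exp.2 ?_
          linarith
      _ = Real.exp (-Real.log p) * Real.exp (-(2 * Real.log p)) * Real.exp (-((2 + Cg) * L)) := by
          rw [Real.exp_add, Real.exp_add]
      _ ≤ κ₀ * κ * σ ^ 2 / 2 * (L / n) * (2 * ρ * Real.exp (-(Cg * Real.log p))) ^ s := by gcongr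
      _ ≤ κ₀ * v / 2 * (L / n) * (2 * ρ * Real.exp (-(Cg * Real.log p))) ^ s := by
          rw [mul_assoc κ₀]
          gcongr
      _ = _ := by rw [← hsdef]; ring
  · intro t ht j x hx
    have ht0 : 0 < t := hv0.trans_le ht.1
    -- The random variance may lie below σ², which inflates the standardized signal; the choice of κ
    -- keeps it below 2γ/(1 + γ) E, leaving a margin (1 - γ)/(1 + γ) E for ρ.
    have hst : σ * ((1 + γ) / 2) ≤ √t := by
      refine Real.le_sqrt_of_sq_le ?_
      rw [mul_pow, ← hκ]
      linarith [ht.1]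
    have hst0 : 0 < √t := Real.sqrt_pos.2 ht0
    have hE0 : 0 ≤ γ * E := (abs_nonneg _).trans (hβ j)
    have h3 : |βs j / √t| ≤ 2 * γ / (1 + γ) * E := by
      have h4 := hβ j
      rw [abs_div, abs_of_pos hσ, div_le_iff₀ hσ] at h4
      rw [abs_div, abs_of_pos hst0, div_le_iff₀ hst0]
      calc |βs j| ≤ γ * E * σ := h4
        _ = 2 / (1 + γ) * (γ * E) * (σ * ((1 + γ) / 2)) := by field_simp
        _ ≤ 2 / (1 + γ) * (γ * E) * √t := by gcongr
        _ = _ := by ring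
    have h5 : 2 * γ / (1 + γ) * E + (1 - γ) / (1 + γ) * E = E := by field_simp; ring
    have h6 := abs_le.1 h3
    refine hδ x ⟨?_, ?_⟩
    · linarith [hx.1]
    · linarith [hx.2]
  · intro t ht
    refine hIG t ⟨hv1.trans ht.1, ht.2.trans ?_⟩
    have : L / n ≤ 1 := (div_le_one hn0).2 hLn
    calc v * (1 + L / n) ≤ 2 * σ ^ 2 * (1 + 1) := by gcongr
      _ = 4 * σ ^ 2 := by ring

end FixedSampleSize

section FixedSampleSize

variable {n p : ℕ} {X : Matrix (Fin n) (Fin p) ℝ} {a₀ b₀ : ℝ} {g : ℝ → ℝ}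

/-- Being an embedding lets the image law be evaluated on arbitrary sets, so measurability of the
posterior event is not needed. -/
theorem measurableEmbedding_affine (m : Fin n → ℝ) {σ : ℝ} (hσ : σ ≠ 0) :
    MeasurableEmbedding fun e : Fin n → ℝ => m + σ • e :=
  (measurableEmbedding_addLeft m).comp (measurableEmbedding_const_smul₀ hσ)

/-- The response avoids, up to small probability, the noise vectors with atypical norm or large
correlation with the design, and those for which parameters with many large coefficients are too
likely. -/
theorem dataLaw_le_of_good_noise {βs : Fin p → ℝ} {σ κ T x : ℝ} {k k' : ℕ}
    (hgm : Measurable g) (hn : n ≠ 0) (hp : 0 < p) (hσ : 0 < σ) (hκ0 : 0 < κ) (hκ1 : κ ≤ 1)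
    {ρ : ℝ} {S : Set (Fin n → ℝ)}
    (hS : ∀ e : Fin n → ℝ, κ * n ≤ ∑ i, e i ^ 2 → ∑ i, e i ^ 2 ≤ 2 * n →
      SparseNoiseBound X k' T e →
      unnormalizedPosterior a₀ b₀ g X (X.mulVec βs + σ • e) (manyLarge p k ρ) ≤
        ENNReal.ofReal (Real.exp (-x) * likelihood X (X.mulVec βs + σ • e) (βs, σ ^ 2)) →
      X.mulVec βs + σ • e ∉ S) :
    dataLaw X βs σ S ≤ ENNReal.ofReal (Real.exp x) * priorMeasure a₀ b₀ g p (manyLarge p k ρ) +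
      ENNReal.ofReal (Real.exp (-(1 - Real.log 2) / 2 * n)) +
      ENNReal.ofReal (Real.exp (-(κ - 1 - Real.log κ) / 2 * n)) +
      ENNReal.ofReal ((p * √2) ^ k' * Real.exp (-(T / 4))) := by
  set φ : (Fin n → ℝ) → (Fin n → ℝ) := fun e => X.mulVec βs + σ • e
  have hφ : MeasurableEmbedding φ := measurableEmbedding_affine _ hσ.ne'
  have hlaw : ∀ A, dataLaw X βs σ A = (Measure.pi fun _ : Fin n => gaussianReal 0 1) (φ ⁻¹' A) :=
    fun A => hφ.map_apply _ A
  have hB := dataLaw_unnormalizedPosterior_gt_le (a₀ := a₀) (b₀ := b₀) hgm hn X βs hσ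
    (Real.exp_pos (-x)) (manyLarge p k ρ)
  rw [← Real.exp_neg, neg_neg, hlaw] at hB
  rw [hlaw]
  refine (measure_mono ?_).trans ((measure_union_le _ _).trans (add_le_add
    ((measure_union_le _ _).trans (add_le_add ((measure_union_le _ _).trans
      (add_le_add hB (pi_gaussianReal_sum_sq_ge_le n)))
      (pi_gaussianReal_sum_sq_le_le hκ0 hκ1 n))) (pi_gaussianReal_sparse_le X k' T hp)))
  intro e he
  by_contra hcon
  simp only [Set.mem_union, not_or] at hcon
  obtain ⟨⟨⟨h1, h2⟩, h3⟩, h4⟩ := hcon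
  simp only [Set.mem_preimage, Set.mem_ofPred_eq, not_lt, not_le, not_exists, not_and] at h1 h2 h3 h4
  exact hS e h3.le h2.le h4 h1 he

-- Bookkeeping in the scale Λ: the evidence costs at most e^Λ, and each piece of the numerator is
-- O(e^{-3Λ}), leaving O(e^{-2Λ}). Each bad noise event also has probability O(e^{-2Λ}). One spare
-- factor e^{-Λ} absorbs the constants through `hbig`.
set_option maxHeartbeats 1000000 in
theorem dataLaw_posterior_ge_le {βs : Fin p → ℝ} {σ γ E C Cg Cπ u κ κ₀ M B₀ c₁ : ℝ}
    (ha : 0 < a₀) (hb : 0 < b₀) (hgm : Measurable g) (hg0 : ∀ x, 0 ≤ g x) (hg1 : ∫ x, g x = 1)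
    (hX : ∀ i j, |X i j| ≤ 1)
    (hn : n ≠ 0) (hp : 2 ≤ p) (hs : 1 ≤ sparsity βs) (hσ : 0 < σ)
    (hγ0 : 0 < γ) (hγ1 : γ < 1) (hβ : ∀ j, |βs j / σ| ≤ γ * E) (hC : 1 ≤ C) (hu : 0 < u)
    (hκ : κ = ((1 + γ) / 2) ^ 2)
    (hconc : 1 - ∫ x in Set.Icc (-(C * baseRate (sparsity βs) p n / p))
      (C * baseRate (sparsity βs) p n / p), g x ≤ (p : ℝ) ^ (-(1 + u)))
    (hpu : (p : ℝ) ^ (-u) ≤ 1 / 2)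
    (hρE : C * baseRate (sparsity βs) p n / p ≤ (1 - γ) / (1 + γ) * E)
    (hδ : ∀ x ∈ Set.Icc (-E) E, Real.exp (-(Cg * Real.log p)) ≤ g x)
    (hnp : (n : ℝ) ≤ p ^ 2) (hL1 : 1 ≤ sparsity βs * Real.log p)
    (hLn : sparsity βs * Real.log p ≤ n)
    (hκ₀ : 0 < κ₀) (hIG : ∀ t ∈ Set.Icc (κ * σ ^ 2) (4 * σ ^ 2), κ₀ ≤ invGammaPDF a₀ b₀ t)
    (hκ₀p : 1 ≤ p * (κ₀ * κ * σ ^ 2 / 2))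
    (hCπ : 0 ≤ Cπ) (hπ : ∫⁻ t, ENNReal.ofReal (invGammaPDF a₀ b₀ t) ≤ ENNReal.ofReal Cπ)
    (hM : 1 ≤ M) (hB₀ : 8 * (2 + 5 / u) + 8 ≤ B₀)
    (hMH : C ^ 2 / 2 + 11 / 2 + Cg + √B₀ * C / √κ ≤ M) (hCg : 0 ≤ Cg)
    (hc1 : 2 * C * Real.exp (5 / 2) ≤ c₁) (hc2 : 8 * √B₀ ≤ c₁) (hc3 : 7 ≤ c₁)
    (hbig : 3 + 2 * Cπ < Real.exp (M ^ 2 * (sparsity βs * Real.log p)))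
    (hn1 : 2 * (M ^ 2 * (sparsity βs * Real.log p)) ≤ (1 - Real.log 2) / 2 * n)
    (hn2 : 2 * (M ^ 2 * (sparsity βs * Real.log p)) ≤ (κ - 1 - Real.log κ) / 2 * n)
    (hn3 : 3 * (M ^ 2 * (sparsity βs * Real.log p)) ≤ n)
    (hn4 : c₁ ^ 2 * (M ^ 2 * (sparsity βs * Real.log p)) ≤ 4 * n) :
    dataLaw X βs σ {y | ENNReal.ofReal (Real.exp (-(M ^ 2 * (sparsity βs * Real.log p)))) ≤
        posterior a₀ b₀ g X y {θ | c₁ * σ * (M * √(sparsity βs * Real.log p)) ≤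
          l2norm (X.mulVec θ.1 - X.mulVec βs)}} ≤
      ENNReal.ofReal (Real.exp (-(M ^ 2 * (sparsity βs * Real.log p)))) := by
  have hn0 : (0 : ℝ) < n := by exact_mod_cast Nat.pos_of_ne_zero hn
  have hp2 : (2 : ℝ) ≤ p := by exact_mod_cast hp
  have hp0 : (0 : ℝ) < p := by linarith
  set s := sparsity βs with hsdef
  have hs1 : (1 : ℝ) ≤ s := by exact_mod_cast hs
  set L := s * Real.log p with hLdef
  have hlogp : 0 < Real.log p := Real.log_pos (by linarith)
  set r := baseRate s p n
  set ρ := C * r / p with hρdef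
  have hr0 : 0 ≤ r := Real.sqrt_nonneg _
  have hρ0 : 0 ≤ ρ := by positivity
  have hL0 : 0 < L := by linarith
  have hω : √n * (p * ρ) = C * √L := by
    rw [hLdef, ← sqrt_mul_baseRate hn s, hρdef]
    field_simp
    rfl
  have hκpos : 0 < κ := by rw [hκ]; positivity
  have hκ1 : κ ≤ 1 := by
    rw [hκ]
    exact pow_le_one₀ (by linarith) (by linarith)
  set Λ := M ^ 2 * L with hΛdef
  have hM2 : 1 ≤ M ^ 2 := one_le_pow₀ hM
  have hΛ0 : 0 < Λ := by positivity
  have hB₀0 : 0 ≤ B₀ := le_trans (by positivity) hB₀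
  have hc₁0 : 0 ≤ c₁ := by linarith
  -- Chosen so that the prior factor p^{-uk} is at most e^{-5Λ}: 3Λ is spent in Markov's inequality
  -- and 2Λ remains.
  set k := ⌈5 * M ^ 2 * s / u⌉₊
  set k' := s + k
  -- The union bound costs 2k' log p ≤ 2(2 + 5/u)Λ, so T/4 must exceed this by 2Λ, whence the lower
  -- bound on `B₀`.
  set T := B₀ * Λ
  have hT0 : 0 ≤ T := by positivity
  have hsT : √T = √B₀ * (M * √L) := by
    simp only [T, hΛdef]
    rw [Real.sqrt_mul hB₀0, Real.sqrt_mul (by positivity), Real.sqrt_sq (by linarith)]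
  set D := c₁ * σ * (M * √L) with hDdef
  have hsL : 0 < √L := Real.sqrt_pos.2 hL0
  have hsL2 : √L ^ 2 = L := Real.sq_sqrt hL0.le
  have hD2 : D ^ 2 = c₁ ^ 2 * σ ^ 2 * Λ := by
    calc D ^ 2 = c₁ ^ 2 * σ ^ 2 * (M ^ 2 * √L ^ 2) := by rw [hDdef]; ring
      _ = _ := by rw [hsL2]
  have hk1 : 5 * M ^ 2 * s / u ≤ k := Nat.le_ceil _
  have hk2 : (k : ℝ) ≤ 5 * M ^ 2 * s / u + 1 := (Nat.ceil_lt_add_one (by positivity)).le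
  have hk'A : (k' : ℝ) ≤ (2 + 5 / u) * (M ^ 2 * s) := by
    have h1 : (1 : ℝ) ≤ M ^ 2 * s := one_le_mul_of_one_le_of_one_le hM2 hs1
    have h2 : (s : ℝ) ≤ M ^ 2 * s := le_mul_of_one_le_left (Nat.cast_nonneg _) hM2
    have h3 : (k' : ℝ) = s + k := by simp [k']
    rw [h3]
    calc (s : ℝ) + k ≤ M ^ 2 * s + (5 * M ^ 2 * s / u + M ^ 2 * s) := by linarith
      _ = _ := by ring
  have hhalf : Real.exp (-(2 * Λ)) * Real.exp Λ = Real.exp (-Λ) := by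
    rw [← Real.exp_add]; congr 1; ring
  have hB1 : ENNReal.ofReal (Real.exp (3 * Λ)) * priorMeasure a₀ b₀ g p (manyLarge p k ρ) ≤
      ENNReal.ofReal (Cπ * Real.exp (-(2 * Λ))) := by
    have h1 := priorMeasure_manyLarge_le ha hb hgm hg0 hg1 p k
      (by positivity : (0 : ℝ) ≤ (p : ℝ) ^ (-(1 + u))) hconc
    have h2 : ((p : ℝ) * (p : ℝ) ^ (-(1 + u))) ^ k ≤ Real.exp (-(5 * Λ)) := by
      have h := Real.rpow_add hp0 1 (-(1 + u))
      rw [Real.rpow_one] at h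
      rw [← h, Real.rpow_def_of_pos hp0, ← Real.exp_nat_mul]
      refine Real.exp_le_exp.2 ?_
      have h3 : 5 * M ^ 2 * s / u * (u * Real.log p) ≤ k * (u * Real.log p) := by gcongr
      have h4 : 5 * M ^ 2 * s / u * (u * Real.log p) = 5 * Λ := by
        simp only [hΛdef, hLdef]; field_simp
      rw [h4] at h3
      linarith
    calc _ ≤ ENNReal.ofReal (Real.exp (3 * Λ)) *
          (ENNReal.ofReal Cπ * ENNReal.ofReal (Real.exp (-(5 * Λ)))) := by
          gcongr
          exact h1.trans (mul_le_mul' hπ (ENNReal.ofReal_le_ofReal h2))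
      _ = _ := by
          rw [← ENNReal.ofReal_mul hCπ, ← ENNReal.ofReal_mul (Real.exp_pos _).le]
          congr 1
          rw [mul_left_comm, ← Real.exp_add]
          congr 2
          ring
  have hB4 : ((p : ℝ) * √2) ^ k' * Real.exp (-(T / 4)) ≤ Real.exp (-(2 * Λ)) := by
    have h1 : (p : ℝ) * √2 ≤ Real.exp (2 * Real.log p) := by
      have : √2 ≤ p := (Real.sqrt_le_iff.2 ⟨hp0.le, by
        calc (2 : ℝ) ≤ 2 ^ 2 := by norm_num
          _ ≤ p ^ 2 := by gcongr⟩)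
      rw [two_mul, Real.exp_add, Real.exp_log hp0]
      gcongr
    calc ((p : ℝ) * √2) ^ k' * Real.exp (-(T / 4))
        ≤ Real.exp (2 * Real.log p) ^ k' * Real.exp (-(T / 4)) := by gcongr
      _ = Real.exp (k' * (2 * Real.log p) + -(T / 4)) := by rw [← Real.exp_nat_mul, Real.exp_add]
      _ ≤ _ := by
        refine Real.exp_le_exp.2 ?_
        have h2 : k' * (2 * Real.log p) ≤ (2 + 5 / u) * (M ^ 2 * s) * (2 * Real.log p) := by gcongr
        have h3 : (2 + 5 / u) * (M ^ 2 * s) * (2 * Real.log p) = 2 * (2 + 5 / u) * Λ := by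
          simp only [hΛdef, hLdef]; ring
        have h4 : (8 * (2 + 5 / u) + 8) * Λ ≤ T := by simp only [T]; gcongr
        linarith
  refine (dataLaw_le_of_good_noise (a₀ := a₀) (b₀ := b₀) (g := g) (k := k) (k' := k') (T := T)
    (x := 3 * Λ) (ρ := ρ) (κ := κ) hgm hn (by omega) hσ hκpos hκ1 ?_).trans ?_
  · intro e hQ1 hQ2 hN hB hmem
    set v := σ ^ 2 * (∑ i, e i ^ 2) / n with hvdef
    have hσ2 := sq_pos_of_pos hσ
    have hv1 : κ * σ ^ 2 ≤ v := by
      rw [hvdef, le_div_iff₀ hn0]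
      calc κ * σ ^ 2 * n = σ ^ 2 * (κ * n) := by ring
        _ ≤ _ := by gcongr
    have hv2 : v ≤ 2 * σ ^ 2 := by
      rw [hvdef, div_le_iff₀ hn0]
      calc σ ^ 2 * ∑ i, e i ^ 2 ≤ σ ^ 2 * (2 * n) := by gcongr
        _ = _ := by ring
    have hbox := exp_le_priorMeasure_nearBox ha hb hgm hg0 hg1 hn hp hs hσ hγ0 hγ1 hβ hC hκ hconc
      hpu hρE hδ hnp hL1 hLn hκ₀ hIG hκ₀p hv1 hv2
    have hpost := posterior_le (a₀ := a₀) (b₀ := b₀) (g := g) (D := D) (κ := κ) hn hσ hX hgm hT0 hρ0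
      hN (by omega) le_rfl hκpos (by positivity : 0 ≤ L / n) hQ1 hQ2 hB hbox hCπ
      ((priorMeasure_univ_le ha hb hgm hg0 hg1 p).trans hπ) (by positivity)
      (by
        rw [hω, hDdef]
        calc 2 * (C * √L) * (Real.exp (5 / 2) * σ) = 2 * C * Real.exp (5 / 2) * σ * (1 * √L) := by
              ring
          _ ≤ _ := by gcongr)
      (by
        rw [hsT, hDdef]
        calc 8 * σ * (√B₀ * (M * √L)) = 8 * √B₀ * σ * (M * √L) := by ring
          _ ≤ _ := by gcongr)
      (by
        rw [hD2]
        calc c₁ ^ 2 * σ ^ 2 * Λ = σ ^ 2 * (c₁ ^ 2 * Λ) := by ring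
          _ ≤ σ ^ 2 * (4 * n) := by gcongr
          _ = _ := by ring)
    have hexp := (le_trans hmem hpost)
    rw [ENNReal.ofReal_le_ofReal_iff (by positivity)] at hexp
    have hH : n * (L / n) / 2 + √T * (√n * (p * ρ)) / √κ + (√n * (p * ρ)) ^ 2 / 2 + (5 + Cg) * L ≤
        Λ := by
      have h1 : n * (L / n) / 2 + √T * (√n * (p * ρ)) / √κ + (√n * (p * ρ)) ^ 2 / 2 +
          (5 + Cg) * L = (C ^ 2 / 2 + 11 / 2 + Cg) * L + √B₀ * C / √κ * M * L := by
        rw [hω, hsT]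
        have : √B₀ * (M * √L) * (C * √L) = √B₀ * C * M * L := by
          calc _ = √B₀ * C * M * √L ^ 2 := by ring
            _ = _ := by rw [hsL2]
        rw [this, mul_pow, hsL2, mul_div_cancel₀ _ hn0.ne']
        ring
      rw [h1]
      calc (C ^ 2 / 2 + 11 / 2 + Cg) * L + √B₀ * C / √κ * M * L
          ≤ (C ^ 2 / 2 + 11 / 2 + Cg) * M * L + √B₀ * C / √κ * M * L := by
            gcongr
            exact le_mul_of_one_le_right (by positivity) hM
        _ = (C ^ 2 / 2 + 11 / 2 + Cg + √B₀ * C / √κ) * M * L := by ring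
        _ ≤ M * M * L := by gcongr
        _ = Λ := by rw [hΛdef]; ring
    -- The inequality must be strict, since the exceptional event is defined with ≤.
    have hfin : Real.exp (n * (L / n) / 2 + √T * (√n * (p * ρ)) / √κ + (√n * (p * ρ)) ^ 2 / 2 +
        (5 + Cg) * L) * (Cπ * Real.exp (-n) + Real.exp (-(3 * Λ)) +
          Cπ * Real.exp (-(D ^ 2 / (16 * σ ^ 2)))) < Real.exp (-Λ) := by
      have hD16 : 3 * Λ ≤ D ^ 2 / (16 * σ ^ 2) := by
        rw [hD2, le_div_iff₀ (by positivity)]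
        have : 48 ≤ c₁ ^ 2 := by
          calc (48 : ℝ) ≤ 7 ^ 2 := by norm_num
            _ ≤ c₁ ^ 2 := by gcongr
        calc 3 * Λ * (16 * σ ^ 2) = 48 * σ ^ 2 * Λ := by ring
          _ ≤ _ := by gcongr
      calc _ ≤ Real.exp Λ * (Cπ * Real.exp (-(3 * Λ)) + Real.exp (-(3 * Λ)) +
          Cπ * Real.exp (-(3 * Λ))) := by gcongr
        _ = (2 * Cπ + 1) * Real.exp (-(2 * Λ)) := by
          have : Real.exp (-(2 * Λ)) = Real.exp Λ * Real.exp (-(3 * Λ)) := by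
            rw [← Real.exp_add]; congr 1; ring
          rw [this]; ring
        _ < Real.exp Λ * Real.exp (-(2 * Λ)) := by
          gcongr
          linarith
        _ = Real.exp (-Λ) := by rw [mul_comm, hhalf]
    linarith
  · calc _ ≤ ENNReal.ofReal (Cπ * Real.exp (-(2 * Λ))) + ENNReal.ofReal (Real.exp (-(2 * Λ))) +
        ENNReal.ofReal (Real.exp (-(2 * Λ))) + ENNReal.ofReal (Real.exp (-(2 * Λ))) := by
          refine add_le_add (add_le_add (add_le_add hB1 ?_) ?_) (ENNReal.ofReal_le_ofReal hB4)
          · refine ENNReal.ofReal_le_ofReal (Real.exp_le_exp.2 ?_)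
            linarith
          · refine ENNReal.ofReal_le_ofReal (Real.exp_le_exp.2 ?_)
            linarith
      _ = ENNReal.ofReal ((Cπ + 3) * Real.exp (-(2 * Λ))) := by
          rw [← ENNReal.ofReal_add (by positivity) (by positivity),
            ← ENNReal.ofReal_add (by positivity) (by positivity),
            ← ENNReal.ofReal_add (by positivity) (by positivity)]
          congr 1
          ring
      _ ≤ ENNReal.ofReal (Real.exp (-Λ)) := by
          refine ENNReal.ofReal_le_ofReal ?_
          rw [← hhalf, mul_comm]
          gcongr
          linarith

end FixedSampleSize

/-! ### Asymptotic conditions turned into eventual inequalities. -/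

theorem exists_pos_le_invGammaPDF {a b t₁ t₂ : ℝ} (ha : 0 < a) (hb : 0 < b) (h1 : 0 < t₁)
    (h12 : t₁ ≤ t₂) : ∃ κ₀ > 0, ∀ t ∈ Set.Icc t₁ t₂, κ₀ ≤ invGammaPDF a b t := by
  have hpos : ∀ t ∈ Set.Icc t₁ t₂, 0 < t := fun t ht => h1.trans_le ht.1
  have hc : ContinuousOn (invGammaPDF a b) (Set.Icc t₁ t₂) := by
    have : ContinuousOn (fun t : ℝ => b ^ a / Real.Gamma a * t ^ (-a - 1) * Real.exp (-b / t))
        (Set.Icc t₁ t₂) := by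
      refine ContinuousOn.mul (ContinuousOn.mul continuousOn_const ?_) ?_
      · exact continuousOn_id.rpow_const fun t ht => Or.inl (hpos t ht).ne'
      · exact (continuousOn_const.div continuousOn_id fun t ht => (hpos t ht).ne').rexp
    refine this.congr fun t ht => ?_
    simp [invGammaPDF, hpos t ht]
  obtain ⟨t₀, ht₀, hmin⟩ := isCompact_Icc.exists_isMinOn ⟨t₁, le_rfl, h12⟩ hc
  refine ⟨invGammaPDF a b t₀, ?_, fun t ht => hmin ht⟩
  have := Real.Gamma_pos_of_pos ha
  have := hpos t₀ ht₀
  rw [invGammaPDF, if_pos this]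
  positivity

theorem tendsto_dimension {p : ℕ → ℕ}
    (h : (fun n : ℕ => (n : ℝ)) =O[atTop] fun n => (p n : ℝ)) :
    Tendsto (fun n => (p n : ℝ)) atTop atTop := by
  have := h.trans_tendsto_norm_atTop (by simpa using tendsto_natCast_atTop_atTop (R := ℝ))
  simpa using this

theorem eventually_le_dimension_sq {p : ℕ → ℕ}
    (h : (fun n : ℕ => (n : ℝ)) =O[atTop] fun n => (p n : ℝ)) :
    ∀ᶠ n : ℕ in atTop, (n : ℝ) ≤ (p n : ℝ) ^ 2 := by
  obtain ⟨K, hK⟩ := h.bound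
  filter_upwards [hK, (tendsto_dimension h).eventually_ge_atTop K] with n h1 h2
  simp only [Real.norm_natCast] at h1
  calc (n : ℝ) ≤ K * p n := h1
    _ ≤ p n * p n := by gcongr
    _ = _ := (sq _).symm

section Prior

variable {p : ℕ → ℕ} {βs : ∀ n, Fin (p n) → ℝ} {E : ℕ → ℝ} {g : ℕ → ℝ → ℝ}

/-- The prior concentration condition, with an explicit multiple of the rate as half-width. -/
theorem PriorCondition.exists_concentration (hg : PriorCondition p βs E g)
    (hg0 : ∀ n x, 0 ≤ g n x) (hg1 : ∀ n, ∫ x, g n x = 1) :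
    ∃ u C : ℝ, 0 < u ∧ 1 ≤ C ∧ ∀ᶠ n in atTop,
      1 - ∫ x in Set.Icc (-(C * baseRate (sparsity (βs n)) (p n) n / p n))
        (C * baseRate (sparsity (βs n)) (p n) n / p n), g n x ≤ (p n : ℝ) ^ (-(1 + u)) := by
  obtain ⟨u, a, hu, ha, hc⟩ := hg.concentration
  obtain ⟨K, hK⟩ := ha.1.bound
  refine ⟨u, max K 1, hu, le_max_right _ _, ?_⟩
  filter_upwards [hK, hc] with n h1 h2
  have hr : 0 ≤ baseRate (sparsity (βs n)) (p n) n / p n := by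
    unfold baseRate; positivity
  rw [Real.norm_of_nonneg hr] at h1
  have h3 : a n ≤ max K 1 * baseRate (sparsity (βs n)) (p n) n / p n := by
    rw [mul_div_assoc]
    calc a n ≤ ‖a n‖ := le_abs_self _
      _ ≤ _ := h1
      _ ≤ _ := by gcongr; exact le_max_left _ _
  refine le_trans (sub_le_sub_left ?_ 1) h2
  refine setIntegral_mono_set (integrable_of_integral_eq_one (hg1 n)).integrableOn
    (ae_of_all _ fun x => hg0 n x) (Set.Icc_subset_Icc (neg_le_neg h3) h3).eventuallyLE

/-- The concentration condition forces the true coefficients to be nonzero. -/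
theorem eventually_one_le_sparsity {u C : ℝ} (hu : 0 < u)
    (hp : Tendsto (fun n => (p n : ℝ)) atTop atTop)
    (hc : ∀ᶠ n in atTop,
      1 - ∫ x in Set.Icc (-(C * baseRate (sparsity (βs n)) (p n) n / p n))
        (C * baseRate (sparsity (βs n)) (p n) n / p n), g n x ≤ (p n : ℝ) ^ (-(1 + u))) :
    ∀ᶠ n in atTop, 1 ≤ sparsity (βs n) := by
  filter_upwards [hc, hp.eventually_gt_atTop 1] with n h1 h2
  by_contra hs
  have hs0 : sparsity (βs n) = 0 := by omega
  -- With s = 0 the interval shrinks to a point of zero mass, so concentration would say 1 ≤ p^{-(1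
  -- + u)}.
  have hr : baseRate (sparsity (βs n)) (p n) n = 0 := by simp [baseRate, hs0]
  rw [hr] at h1
  have h3 := Real.rpow_lt_one_of_one_lt_of_neg h2 (by linarith : -(1 + u) < 0)
  simp only [mul_zero, zero_div, neg_zero, Set.Icc_self, integral_singleton, measureReal_def,
    Real.volume_singleton, ENNReal.toReal_zero, zero_smul, sub_zero] at h1
  linarith

/-- A single nonzero true coefficient makes E positive at that index, and monotonicity propagates
the bound. It ensures that ρ = O(1/p) eventually fits into a fixed fraction of E. -/
theorem SignalCondition.exists_pos_eventually_le {σs γ : ℝ} (hA : SignalCondition p βs σs E)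
    (hσs : 0 < σs) (hγ : 0 < γ) (hβ : ∀ᶠ n in atTop, ∀ j, |βs n j / σs| ≤ γ * E n)
    (hs : ∀ᶠ n in atTop, 1 ≤ sparsity (βs n)) : ∃ E₀ > 0, ∀ᶠ n in atTop, E₀ ≤ E n := by
  obtain ⟨n₀, h1, h2⟩ := (hβ.and hs).exists
  refine ⟨E n₀, ?_, (eventually_ge_atTop n₀).mono fun n hn => hA.monotone_E hn⟩
  obtain ⟨j, hj⟩ := Finset.card_pos.1 h2
  have hj0 : βs n₀ j ≠ 0 := by simpa using hj
  have h3 : 0 < |βs n₀ j / σs| := abs_pos.2 (div_ne_zero hj0 hσs.ne')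
  exact pos_of_mul_pos_right (h3.trans_le (h1 j)) hγ.le

theorem PriorCondition.exists_thickness (hg : PriorCondition p βs E g)
    (hg0 : ∀ n x, 0 ≤ g n x) (hp : Tendsto (fun n => (p n : ℝ)) atTop atTop) :
    ∃ Cg : ℝ, 0 ≤ Cg ∧ ∀ᶠ n in atTop, ∀ x ∈ Set.Icc (-E n) (E n),
      Real.exp (-(Cg * Real.log (p n))) ≤ g n x := by
  obtain ⟨K, hK0, hK⟩ := hg.thick.exists_nonneg
  refine ⟨K, hK0, ?_⟩
  filter_upwards [hK.bound, hg.thick_pos, hp.eventually_ge_atTop 1] with n h1 h2 h3 x hx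
  rw [Real.norm_of_nonneg (Real.log_nonneg h3)] at h1
  have h4 := (le_abs_self _).trans h1
  calc Real.exp (-(K * Real.log (p n))) ≤ sInf (g n '' Set.Icc (-E n) (E n)) := by
        rw [← Real.exp_log h2]
        exact Real.exp_le_exp.2 (by linarith)
    _ ≤ g n x := csInf_le ⟨0, by rintro _ ⟨z, -, rfl⟩; exact hg0 n z⟩ ⟨x, hx, rfl⟩

theorem SignalCondition.eventually_mul_le {σs : ℝ} (hA : SignalCondition p βs σs E) {K : ℝ}
    (hK : 0 < K) {c : ℝ} (hc : 0 < c) :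
    ∀ᶠ n : ℕ in atTop, K * (sparsity (βs n) * Real.log (p n)) ≤ c * n := by
  filter_upwards [hA.sparse.bound (div_pos hc hK)] with n h
  rw [Real.norm_natCast] at h
  have h1 := (le_abs_self _).trans h
  calc K * (sparsity (βs n) * Real.log (p n)) ≤ K * (c / K * n) := by gcongr
    _ = c * n := by field_simp

end Prior

end Shrinkage

open Shrinkage in
theorem theorem2
    (p : ℕ → ℕ) (X : ∀ n, Matrix (Fin n) (Fin (p n)) ℝ) (βs : ∀ n, Fin (p n) → ℝ)
    (σs : ℝ) (hσs : 0 < σs) (E : ℕ → ℝ)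
    (a₀ b₀ : ℝ) (ha₀ : 0 < a₀) (hb₀ : 0 < b₀)
    (g : ℕ → ℝ → ℝ) (hg_meas : ∀ n, Measurable (g n)) (hg_nonneg : ∀ n x, 0 ≤ g n x)
    (hg_int : ∀ n, ∫ x, g n x = 1)
    (hA₁ : DesignCondition p X βs) (hA₂ : SignalCondition p βs σs E)
    (hg : PriorCondition p βs E g) :
    ∃ c₁ c₂ c₃ M₀ : ℝ, 0 < c₁ ∧ 0 < c₂ ∧ 0 < c₃ ∧ 0 < M₀ ∧
      ∀ M : ℝ, M₀ ≤ M → ∀ ε : ℕ → ℝ, (∀ n, ε n = M * baseRate (sparsity (βs n)) (p n) n) →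
        ∀ᶠ n in atTop,
          dataLaw (X n) (βs n) σs
              {y | ENNReal.ofReal (Real.exp (-(c₂ * n * ε n ^ 2))) ≤
                posterior a₀ b₀ (g n) (X n) y
                  {θ | c₁ * σs * √n * ε n ≤
                    l2norm ((X n).mulVec θ.1 - (X n).mulVec (βs n))}} ≤
            ENNReal.ofReal (Real.exp (-(c₃ * n * ε n ^ 2))) := by
  have hp := tendsto_dimension hA₁.high_dim
  obtain ⟨u, C, hu, hC, hconc⟩ := hg.exists_concentration hg_nonneg hg_int
  have hs := eventually_one_le_sparsity hu hp hconc
  obtain ⟨γ, hγ0, hγ1, hβ⟩ := hA₂.magnitude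
  obtain ⟨E₀, hE₀, hE⟩ := hA₂.exists_pos_eventually_le hσs hγ0 hβ hs
  obtain ⟨Cg, hCg, hδ⟩ := hg.exists_thickness hg_nonneg hp
  have hIGfin := lintegral_invGammaPDF_lt_top ha₀ hb₀
  set Cπ := (∫⁻ t, ENNReal.ofReal (invGammaPDF a₀ b₀ t)).toReal
  have hπ : ∫⁻ t, ENNReal.ofReal (invGammaPDF a₀ b₀ t) ≤ ENNReal.ofReal Cπ :=
    (ENNReal.ofReal_toReal hIGfin.ne).ge
  have hCπ : 0 ≤ Cπ := ENNReal.toReal_nonneg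
  -- Between γ² and 1: large enough to keep the standardized signal inside [-E, E], and below 1 so
  -- that ‖ε‖² ≤ κn is exponentially unlikely.
  set κ : ℝ := ((1 + γ) / 2) ^ 2 with hκ
  have hκpos : 0 < κ := by positivity
  have hκ1 : κ < 1 := pow_lt_one₀ (by linarith) (by linarith) two_ne_zero
  obtain ⟨κ₀, hκ₀, hIG⟩ := exists_pos_le_invGammaPDF ha₀ hb₀
    (by positivity : 0 < κ * σs ^ 2) (by nlinarith [sq_pos_of_pos hσs] : κ * σs ^ 2 ≤ 4 * σs ^ 2)
  set B₀ : ℝ := 8 * (2 + 5 / u) + 8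
  -- The summands dominate the small coefficients (with σ up to e^{5/2}σ*), the noise correlation,
  -- and, by 7² ≥ 48, the requirement D²/(16σ*²) ≥ 3Λ.
  set c₁ : ℝ := 2 * C * Real.exp (5 / 2) + 8 * √B₀ + 7
  have hc0 : 0 ≤ 2 * C * Real.exp (5 / 2) := by positivity
  have hc0' : 0 ≤ 8 * √B₀ := by positivity
  -- The evidence loss is at most `M₁ * M * L`, hence at most Λ once M ≥ `M₁`; 11/2 combines 5 from
  -- the prior with 1/2 from the variance window.
  set M₁ := C ^ 2 / 2 + 11 / 2 + Cg + √B₀ * C / √κ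
  refine ⟨c₁, 1, 1, max 1 M₁, by positivity, one_pos, one_pos, by positivity, ?_⟩
  intro M hM ε hε
  have hM1 : 1 ≤ M := (le_max_left _ _).trans hM
  have hM2 : 0 < M ^ 2 := by positivity
  have hlog2 : Real.log 2 < 1 := by linarith [Real.log_two_lt_d9]
  have hκlog : 0 < κ - 1 - Real.log κ := by
    linarith [Real.log_lt_sub_one_of_pos hκpos hκ1.ne]
  have hγE : 0 < (1 - γ) / (1 + γ) * E₀ := by
    have : 0 < 1 - γ := by linarith
    positivity
  have hpu : ∀ᶠ n in atTop, (p n : ℝ) ^ (-u) ≤ 1 / 2 :=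
    (((tendsto_rpow_neg_atTop hu).comp hp).eventually_lt_const (by norm_num)).mono
      fun n h => h.le
  -- M is already fixed here, so s log p = o(n) puts every multiple of Λ below the required multiple
  -- of n.
  filter_upwards [hA₁.bounded, hconc, hs, hβ, hE, hδ, hpu, eventually_ne_atTop 0,
    eventually_le_dimension_sq hA₁.high_dim,
    hp.eventually_ge_atTop (Real.exp 1), hp.eventually_ge_atTop (C / ((1 - γ) / (1 + γ) * E₀)),
    hp.eventually_ge_atTop (1 / (κ₀ * κ * σs ^ 2 / 2)), hp.eventually_gt_atTop (3 + 2 * Cπ),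
    hA₂.eventually_mul_le one_pos one_pos,
    hA₂.eventually_mul_le (K := 2 * M ^ 2) (by positivity)
      (half_pos (sub_pos.2 hlog2)),
    hA₂.eventually_mul_le (K := 2 * M ^ 2) (by positivity) (half_pos hκlog),
    hA₂.eventually_mul_le (K := 3 * M ^ 2) (by positivity) one_pos,
    hA₂.eventually_mul_le (K := c₁ ^ 2 * M ^ 2) (by positivity) (by norm_num : (0 : ℝ) < 4)]
    with n hX hconc hs hβ hE hδ hpu hn hnp hpe hpE hpκ hpbig hL hL1 hL2 hL3 hL4
  have hn0 : (0 : ℝ) < n := by exact_mod_cast Nat.pos_of_ne_zero hn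
  have hp2 : (2 : ℝ) ≤ p n := by linarith [Real.add_one_le_exp 1]
  have hp0 : (0 : ℝ) < p n := by linarith
  have hs1 : (1 : ℝ) ≤ sparsity (βs n) := by exact_mod_cast hs
  have hlog1 : 1 ≤ Real.log (p n) := (Real.le_log_iff_exp_le hp0).2 hpe
  set L := sparsity (βs n) * Real.log (p n) with hLdef
  have hlogL : Real.log (p n) ≤ L := le_mul_of_one_le_left (by linarith) hs1
  have hr0 : 0 ≤ baseRate (sparsity (βs n)) (p n) n := Real.sqrt_nonneg _
  have hr1 : baseRate (sparsity (βs n)) (p n) n ≤ 1 := by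
    refine (pow_le_one_iff_of_nonneg hr0 two_ne_zero).1 ?_
    rw [baseRate_sq, div_le_one hn0]
    linarith
  have hrate : n * ε n ^ 2 = M ^ 2 * L := by
    rw [hε, mul_pow, baseRate_sq, ← hLdef]
    field_simp
  have hdist : c₁ * σs * √n * ε n = c₁ * σs * (M * √L) := by
    rw [hLdef, ← sqrt_mul_baseRate hn, hε]
    ring
  rw [hdist, one_mul, hrate]
  refine dataLaw_posterior_ge_le (γ := γ) (E := E n) (C := C) (Cg := Cg) (Cπ := Cπ) (u := u)
    (κ := κ) (κ₀ := κ₀) (B₀ := B₀) ha₀ hb₀ (hg_meas n) (hg_nonneg n) (hg_int n) hX hn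
    (by exact_mod_cast hp2) hs hσs hγ0 hγ1 hβ hC hu hκ hconc hpu ?_ hδ hnp (by linarith)
    (by linarith) hκ₀ hIG ?_ hCπ hπ hM1 le_rfl ((le_max_right _ _).trans hM) hCg
    (by linarith) (by linarith) (by linarith) ?_ (by linarith) (by linarith) (by linarith)
    (by linarith)
  · have hγ1' : 0 < (1 - γ) / (1 + γ) := by
      have : 0 < 1 - γ := by linarith
      positivity
    calc C * baseRate (sparsity (βs n)) (p n) n / p n ≤ C * 1 / p n := by gcongr
      _ ≤ (1 - γ) / (1 + γ) * E₀ := by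
        rw [mul_one, div_le_comm₀ hp0 hγE]
        exact hpE
      _ ≤ _ := by gcongr
  · rw [← div_le_iff₀ (by positivity)]
    exact hpκ
  · calc 3 + 2 * Cπ < p n := hpbig
      _ = Real.exp (Real.log (p n)) := (Real.exp_log hp0).symm
      _ ≤ _ := by
        refine Real.exp_le_exp.2 (hlogL.trans ?_)
        exact le_mul_of_one_le_left (by linarith) (one_le_pow₀ hM1)
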